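/- **Setting.** Let $(\mathcal W\rightrightarrows E;\ \mathcal G\rightrightarrows M)$ be a VB-groupoid: $\mathcal W\rightrightarrows E$ and $\mathcal G\rightrightarrows M$ are Lie groupoids, $\mathcal W\to\mathcal G$ and $E\to M$ are smooth vector bundles, and projection, zero section, addition and scalar multiplications are morphisms of Lie groupoids. Write $\mathsf s,\mathsf t,\mathsf 1,\mathsf i$ for source, target, units and inversion of $\mathcal W\rightrightarrows E$, $\bar{\mathsf m}(w,w')=w\,w'^{-1}$ for the division map (defined when $\mathsf s(w)=\mathsf s(w')$), $\mathcal W^{(k)}$ for the manifold of composable $k$-tuples of arrows ($\mathsf s(w_i)=\mathsf t(w_{i+1})$), and $W=\ker(T\mathsf s)|_E\to E$ for the Lie algebroid of $\mathcal W\rightrightarrows E$. The deformation complex $(C_{\mathrm{def}}(\mathcal W),\delta)$ is defined as follows. For $k\ge 0$, $C^k_{\mathrm{def}}(\mathcal W)$ is the space of smooth maps $c:\mathcal W^{(k+1)}\to T\mathcal W$ with $c(w_0,\dots,w_k)\in T_{w_0}\mathcal W$ such that $T\mathsf s(c(w_0,\dots,w_k))$ does not depend on $w_0$ (for $k=0$: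 depends only on $\mathsf s(w_0)$), and $$\delta c(w_0,\dots,w_{k+1})=-T\bar{\mathsf m}\big(c(w_0w_1,w_2,\dots,w_{k+1}),c(w_1,\dots,w_{k+1})\big)+\sum_{i=1}^{k}(-1)^{i-1}c(w_0,\dots,w_iw_{i+1},\dots,w_{k+1})+(-1)^kc(w_0,\dots,w_k).$$ Moreover $C^{-1}_{\mathrm{def}}(\mathcal W)=\Gamma(W)$ and $\delta\alpha=\overleftarrow\alpha+\overrightarrow\alpha$, where $\overrightarrow\alpha_w=TR_w(\alpha_{\mathsf t(w)})$ and $\overleftarrow\alpha_w=TL_w(T\mathsf i(\alpha_{\mathsf s(w)}))$, with $R_w$ and $L_w$ right and left multiplication by $w$. For $\lambda>0$ let $h_\lambda$ be the fiberwise multiplication by $\lambda$ on $\mathcal W\to\mathcal G$ (and on $E \to M$); it is an automorphism of $\mathcal W\rightrightarrows E$ and acts on cochains by $(h_\lambda^*c)(w_0,\dots,w_k)=Th_\lambda^{-1}\big(c(\lambda w_0,\dots,\lambda w_k)\big)$ for $k\ge0$ and by $(h_\lambda^*\alpha)_e=Th_\lambda^{-1}(\alpha_{\lambda e})$ for $k=-1$.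 A cochain $c$ is *linear* if $h_\lambda^*c=c$ for all $\lambda>0$; $C_{\mathrm{def,lin}}(\mathcal W)$ is the space of linear deformation cochains. The cohomologies are denoted $H_{\mathrm{def}}(\mathcal W)$ and $H_{\mathrm{def,lin}}(\mathcal W)$. **Theorem.** $\delta$ maps $C_{\mathrm{def}}(\mathcal W)$ and $C_{\mathrm{def,lin}}(\mathcal W)$ to themselves and $\delta^2=0$. For every $c\in C_{\mathrm{def}}(\mathcal W)$ the pointwise limits $$c_{\mathrm{core}}=\lim_{\lambda\to0^+}\lambda\, h_\lambda^*c,\qquad c_{\mathrm{lin}}=\lim_{\lambda\to0^+}\big(h_\lambda^*c-\lambda^{-1}c_{\mathrm{core}}\big)$$ exist, $c_{\mathrm{core}}\in C_{\mathrm{def}}(\mathcal W)$ and $c_{\mathrm{lin}}\in C_{\mathrm{def,lin}}(\mathcal W)$. The linear map $\mathrm{lin}:C_{\mathrm{def}}(\mathcal W)\to C_{\mathrm{def,lin}}(\mathcal W)$, $c\mapsto c_{\mathrm{lin}}$, is a cochain map and restricts to the identity on $C_{\mathrm{def,lin}}(\mathcal W)$, i.e. it splits the inclusion $C_{\mathrm{def,lin}}(\mathcal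 W)\hookrightarrow C_{\mathrm{def}}(\mathcal W)$. In particular $$C_{\mathrm{def}}(\mathcal W)= C_{\mathrm{def,lin}}(\mathcal W)\oplus\ker(\mathrm{lin})$$ as cochain complexes, and the inclusion induces an injection $H_{\mathrm{def,lin}}(\mathcal W)\hookrightarrow H_{\mathrm{def}}(\mathcal W)$ in every degree. -/

import Mathlib

open Bundle Set Filter Topology
open scoped Manifold ContDiff

universe u

noncomputable section

section Tangent

variable {E H : Type*} [NormedAddCommGroup E] [NormedSpace ℝ E] [TopologicalSpace H]
  (I : ModelWithCorners ℝ E H) {G : Type*} [TopologicalSpace G] [ChartedSpace H G]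

/-- The identification of the tangent spaces at two equal points. (In Mathlib every tangent space
has the model vector space as underlying space, so this is the identity map.) -/
def tangentCast {x y : G} (_h : x = y) : TangentSpace I x →ₗ[ℝ] TangentSpace I y :=
  (LinearMap.id : E →ₗ[ℝ] E)

variable {I} in
theorem contMDiff_pi_eval {n : ℕ} (i : Fin n) :
    ContMDiff (ModelWithCorners.pi fun _ : Fin n => I) I ∞ (fun g : Fin n → G => g i) := by
  intro g
  rw [contMDiffAt_iff]
  refine ⟨(continuous_apply i).continuousAt, ?_⟩
  have h : ContDiffWithinAt ℝ ∞ (fun v : Fin n → E => v i)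
      (range (ModelWithCorners.pi fun _ : Fin n => I))
      (extChartAt (ModelWithCorners.pi fun _ : Fin n => I) g g) :=
    (contDiff_apply ℝ E i).contDiffWithinAt
  refine h.congr_of_eventuallyEq ?_ ?_
  · filter_upwards [extChartAt_target_mem_nhdsWithin (I := ModelWithCorners.pi fun _ => I) g]
      with y hy
    exact congrFun ((extChartAt (ModelWithCorners.pi fun _ : Fin n => I) g).right_inv hy) i
  · exact congrFun ((extChartAt (ModelWithCorners.pi fun _ : Fin n => I) g).right_inv
      (mem_extChartAt_target g)) i

variable {E' H' : Type*} [NormedAddCommGroup E'] [NormedSpace ℝ E'] [TopologicalSpace H']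
  {J : ModelWithCorners ℝ E' H'} {N : Type*} [TopologicalSpace N] [ChartedSpace H' N]
  [IsManifold I ∞ G] {I}

theorem contMDiffOn_add_along {b : N → G} {v w : ∀ x : N, TangentSpace I (b x)} {S : Set N}
    (hv : ContMDiffOn J I.tangent ∞ (fun x => (⟨b x, v x⟩ : TangentBundle I G)) S)
    (hw : ContMDiffOn J I.tangent ∞ (fun x => (⟨b x, w x⟩ : TangentBundle I G)) S) :
    ContMDiffOn J I.tangent ∞ (fun x => (⟨b x, v x + w x⟩ : TangentBundle I G)) S := by
  intro x hx
  have hv' := Bundle.contMDiffWithinAt_totalSpace.1 (hv x hx)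
  have hw' := Bundle.contMDiffWithinAt_totalSpace.1 (hw x hx)
  refine Bundle.contMDiffWithinAt_totalSpace.2 ⟨hv'.1, ?_⟩
  refine (hv'.2.add hw'.2).congr_of_eventuallyEq ?_ ?_
  · have hb : ContinuousWithinAt b S x := hv'.1.continuousWithinAt
    have hm := hb ((trivializationAt E (TangentSpace I : G → Type _) (b x)).open_baseSet.mem_nhds
      (mem_baseSet_trivializationAt E (TangentSpace I : G → Type _) (b x)))
    filter_upwards [hm] with y hy
    exact ((trivializationAt E (TangentSpace I : G → Type _) (b x)).linear ℝ hy).1 _ _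
  · exact ((trivializationAt E (TangentSpace I : G → Type _) (b x)).linear ℝ
      (mem_baseSet_trivializationAt E (TangentSpace I : G → Type _) (b x))).1 _ _

theorem contMDiffOn_smul_along {b : N → G} {v : ∀ x : N, TangentSpace I (b x)} {S : Set N} (r : ℝ)
    (hv : ContMDiffOn J I.tangent ∞ (fun x => (⟨b x, v x⟩ : TangentBundle I G)) S) :
    ContMDiffOn J I.tangent ∞ (fun x => (⟨b x, r • v x⟩ : TangentBundle I G)) S := by
  intro x hx
  have hv' := Bundle.contMDiffWithinAt_totalSpace.1 (hv x hx)
  refine Bundle.contMDiffWithinAt_totalSpace.2 ⟨hv'.1, ?_⟩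
  refine (ContMDiffWithinAt.smul (contMDiffWithinAt_const (I' := 𝓘(ℝ, ℝ)) (c := r)) hv'.2).congr_of_eventuallyEq ?_ ?_
  · have hb : ContinuousWithinAt b S x := hv'.1.continuousWithinAt
    have hm := hb ((trivializationAt E (TangentSpace I : G → Type _) (b x)).open_baseSet.mem_nhds
      (mem_baseSet_trivializationAt E (TangentSpace I : G → Type _) (b x)))
    filter_upwards [hm] with y hy
    exact ((trivializationAt E (TangentSpace I : G → Type _) (b x)).linear ℝ hy).2 _ _
  · exact ((trivializationAt E (TangentSpace I : G → Type _) (b x)).linear ℝ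
      (mem_baseSet_trivializationAt E (TangentSpace I : G → Type _) (b x))).2 _ _

theorem contMDiffOn_zero_along {b : N → G} {S : Set N} (hb : ContMDiffOn J I ∞ b S) :
    ContMDiffOn J I.tangent ∞ (fun x => (⟨b x, 0⟩ : TangentBundle I G)) S :=
  (Bundle.contMDiff_zeroSection ℝ (TangentSpace I : G → Type _)).comp_contMDiffOn hb

end Tangent

/-- A Lie groupoid `G ⇉ M`. The composition `mul g h` is meaningful for `s g = t h` only; its
values on other pairs are arbitrary and never used. Smoothness of a map on an embedded submanifold
such as `{(g, h) | s g = t h}` is `ContMDiffOn` on the corresponding subset of the ambient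
manifold. -/
structure LieGroupoid {E H E' H' : Type*} [NormedAddCommGroup E] [NormedSpace ℝ E]
    [TopologicalSpace H] [NormedAddCommGroup E'] [NormedSpace ℝ E'] [TopologicalSpace H']
    (I : ModelWithCorners ℝ E H) (J : ModelWithCorners ℝ E' H')
    (G M : Type u) [TopologicalSpace G] [ChartedSpace H G] [IsManifold I ∞ G]
    [TopologicalSpace M] [ChartedSpace H' M] [IsManifold J ∞ M] where
  s : G → M
  t : G → M
  one : M → G
  inv : G → G
  mul : G → G → G
  s_one : ∀ x, s (one x) = x
  t_one : ∀ x, t (one x) = x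
  s_inv : ∀ g, s (inv g) = t g
  t_inv : ∀ g, t (inv g) = s g
  s_mul : ∀ g h, s g = t h → s (mul g h) = s h
  t_mul : ∀ g h, s g = t h → t (mul g h) = t g
  mul_assoc : ∀ g h k, s g = t h → s h = t k → mul (mul g h) k = mul g (mul h k)
  one_mul : ∀ g, mul (one (t g)) g = g
  mul_one : ∀ g, mul g (one (s g)) = g
  inv_mul : ∀ g, mul (inv g) g = one (s g)
  mul_inv : ∀ g, mul g (inv g) = one (t g)
  submersion_s : Manifold.IsSubmersion I J ∞ s
  submersion_t : Manifold.IsSubmersion I J ∞ t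
  smooth_one : ContMDiff J I ∞ one
  smooth_inv : ContMDiff I I ∞ inv
  smooth_mul : ContMDiffOn (I.prod I) I ∞ (fun p : G × G => mul p.1 p.2) {p | s p.1 = t p.2}

namespace LieGroupoid

section Deformation

variable {E H E' H' : Type*} [NormedAddCommGroup E] [NormedSpace ℝ E]
  [TopologicalSpace H] [NormedAddCommGroup E'] [NormedSpace ℝ E'] [TopologicalSpace H']
  {I : ModelWithCorners ℝ E H} {J : ModelWithCorners ℝ E' H'}
  {G M : Type u} [TopologicalSpace G] [ChartedSpace H G] [IsManifold I ∞ G]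
  [TopologicalSpace M] [ChartedSpace H' M] [IsManifold J ∞ M]
  (𝒢 : LieGroupoid I J G M)

/-- The set of `(n + 1)`-tuples `(g₀, …, gₙ)` of composable arrows. -/
def composable (n : ℕ) : Set (Fin (n + 1) → G) :=
  {g | ∀ i : Fin n, 𝒢.s (g i.castSucc) = 𝒢.t (g i.succ)}

/-- The points on which a cochain of degree `n - 1` is evaluated: the points of `M` for `n = 0`,
and the `n`-tuples of composable arrows for `n > 0`. -/
def Pt : ℕ → Type u
  | 0 => M
  | n + 1 => 𝒢.composable n

/-- The arrow at which the value of a cochain is tangent: the unit `1ₓ` at `x`, respectively the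
first arrow `g₀` of `(g₀, …, gₙ)`. -/
def foot : ∀ n : ℕ, 𝒢.Pt n → G
  | 0, x => 𝒢.one x
  | _ + 1, g => g.1 0

/-- All set-theoretic sections; the deformation cochains are the members of `defCochains` below.
The index is shifted: `Cochain n` is meant for cochains of degree `n - 1`. -/
abbrev Cochain (n : ℕ) := ∀ p : 𝒢.Pt n, TangentSpace I (𝒢.foot n p)

open Classical in
/-- Extension by zero of a section over the composable tuples to all tuples. -/
def extendZero {n : ℕ} (c : 𝒢.Cochain (n + 1)) (g : Fin (n + 1) → G) : TangentSpace I (g 0) :=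
  if h : g ∈ 𝒢.composable n then c ⟨g, h⟩ else 0

theorem extendZero_of_mem {n : ℕ} {c : 𝒢.Cochain (n + 1)} {g : Fin (n + 1) → G}
    (h : g ∈ 𝒢.composable n) : 𝒢.extendZero c g = c ⟨g, h⟩ :=
  dif_pos h

/-- Evaluation of a cochain at a point of `M`. -/
def evalUnit (x : M) : 𝒢.Cochain 0 →ₗ[ℝ] TangentSpace I (𝒢.one x) :=
  LinearMap.proj (φ := fun p : 𝒢.Pt 0 => TangentSpace I (𝒢.foot 0 p)) x

/-- Evaluation of a cochain at a tuple of composable arrows. -/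
def evalTuple {n : ℕ} (g : 𝒢.composable n) : 𝒢.Cochain (n + 1) →ₗ[ℝ] TangentSpace I (g.1 0) :=
  LinearMap.proj (φ := fun p : 𝒢.Pt (n + 1) => TangentSpace I (𝒢.foot (n + 1) p)) g

/-- Degree `-1` deformation cochains: smooth sections of the Lie algebroid `A = ker(Ts)|_M`. -/
def IsAlgebroidSection (α : 𝒢.Cochain 0) : Prop :=
  (∀ x : M, mfderiv I J 𝒢.s (𝒢.one x) (α x) = 0) ∧
  ContMDiff J I.tangent ∞ (fun x : M => (⟨𝒢.one x, α x⟩ : TangentBundle I G))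

/-- Deformation cochains of degree `n ≥ 0`: smooth maps `c` from the manifold of composable
`(n + 1)`-tuples to `TG` with `c (g₀, …, gₙ)` tangent to `G` at `g₀` such that `Ts (c (g₀, …, gₙ))`
does not depend on `g₀`, i.e. depends only on `(g₁, …, gₙ)`, and on the point `s g₀` if `n = 0`
(for `n > 0` the equality `s g₀ = s g₀'` follows from `g₁ = g₁'`). -/
def IsDeformationCochain {n : ℕ} (c : 𝒢.Cochain (n + 1)) : Prop :=
  ContMDiffOn (ModelWithCorners.pi fun _ : Fin (n + 1) => I) I.tangent ∞
    (fun g : Fin (n + 1) → G => (⟨g 0, 𝒢.extendZero c g⟩ : TangentBundle I G))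
    (𝒢.composable n) ∧
  ∀ g g' : 𝒢.composable n, (∀ i : Fin n, g.1 i.succ = g'.1 i.succ) →
    ∀ h : 𝒢.s (g.1 0) = 𝒢.s (g'.1 0),
      tangentCast J h (mfderiv I J 𝒢.s (g.1 0) (c g)) = mfderiv I J 𝒢.s (g'.1 0) (c g')

/-- The space `C^{n-1}_def` of deformation cochains of degree `n - 1`. -/
def defCochains : ∀ n : ℕ, Submodule ℝ (𝒢.Cochain n)
  | 0 =>
    { carrier := {α | 𝒢.IsAlgebroidSection α}
      add_mem' := fun {α β} hα hβ => by
        refine ⟨fun x => ?_, ?_⟩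
        · have := (mfderiv I J 𝒢.s (𝒢.one x)).map_add (α x) (β x)
          exact this.trans (by rw [hα.1 x, hβ.1 x, add_zero])
        · exact contMDiffOn_univ.1
            (contMDiffOn_add_along (contMDiffOn_univ.2 hα.2) (contMDiffOn_univ.2 hβ.2))
      zero_mem' := by
        refine ⟨fun x => (mfderiv I J 𝒢.s (𝒢.one x)).map_zero, ?_⟩
        exact contMDiffOn_univ.1 (contMDiffOn_zero_along (contMDiffOn_univ.2 𝒢.smooth_one))
      smul_mem' := fun r α hα => by
        refine ⟨fun x => ?_, ?_⟩
        · have := (mfderiv I J 𝒢.s (𝒢.one x)).map_smul r (α x)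
          exact this.trans (by rw [hα.1 x, smul_zero])
        · exact contMDiffOn_univ.1 (contMDiffOn_smul_along r (contMDiffOn_univ.2 hα.2)) }
  | n + 1 =>
    { carrier := {c | 𝒢.IsDeformationCochain c}
      add_mem' := fun {c d} hc hd => by
        refine ⟨?_, fun g g' hg h => ?_⟩
        · refine (contMDiffOn_add_along hc.1 hd.1).congr fun g hg => ?_
          rw [𝒢.extendZero_of_mem hg, 𝒢.extendZero_of_mem hg, 𝒢.extendZero_of_mem hg]
          rfl
        · have h1 := (mfderiv I J 𝒢.s (g.1 0)).map_add (c g) (d g)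
          have h2 := (mfderiv I J 𝒢.s (g'.1 0)).map_add (c g') (d g')
          refine (congrArg (tangentCast J h) h1).trans (Eq.trans ?_ h2.symm)
          rw [map_add, hc.2 g g' hg h, hd.2 g g' hg h]
      zero_mem' := by
        refine ⟨?_, fun g g' hg h => ?_⟩
        · refine (contMDiffOn_zero_along (contMDiff_pi_eval (I := I) 0).contMDiffOn).congr
            fun g hg => ?_
          rw [𝒢.extendZero_of_mem hg]
          rfl
        · have h1 := (mfderiv I J 𝒢.s (g.1 0)).map_zero
          have h2 := (mfderiv I J 𝒢.s (g'.1 0)).map_zero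
          refine (congrArg (tangentCast J h) h1).trans (Eq.trans ?_ h2.symm)
          rw [map_zero]
      smul_mem' := fun r c hc => by
        refine ⟨?_, fun g g' hg h => ?_⟩
        · refine (contMDiffOn_smul_along r hc.1).congr fun g hg => ?_
          rw [𝒢.extendZero_of_mem hg, 𝒢.extendZero_of_mem hg]
          rfl
        · have h1 := (mfderiv I J 𝒢.s (g.1 0)).map_smul r (c g)
          have h2 := (mfderiv I J 𝒢.s (g'.1 0)).map_smul r (c g')
          refine (congrArg (tangentCast J h) h1).trans (Eq.trans ?_ h2.symm)
          rw [map_smul, hc.2 g g' hg h] }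

/-! ### The differential -/

/-- The tangent map at `(a, b)` of the division map `(a, b) ↦ a b⁻¹`, defined on the pairs of arrows
with the same source. The values on pairs `(u, v)` with `Ts u = Ts v`, which are the tangent vectors
to the submanifold `{s a = s b}`, do not depend on the choice made by `mfderivWithin`. -/
def tangentDiv (a b : G) :
    TangentSpace I a × TangentSpace I b →ₗ[ℝ] TangentSpace I (𝒢.mul a (𝒢.inv b)) :=
  (mfderivWithin (I.prod I) I (fun p : G × G => 𝒢.mul p.1 (𝒢.inv p.2))
    {p | 𝒢.s p.1 = 𝒢.s p.2} (a, b)).toLinearMap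

/-- The right-invariant vector field `g ↦ TR_g (α_{t g})`, where `R_g` is defined on
`{h | s h = t g}`. -/
def rightInvariant (g : G) : 𝒢.Cochain 0 →ₗ[ℝ] TangentSpace I g :=
  tangentCast I (𝒢.one_mul g) ∘ₗ
    (mfderivWithin I I (fun h => 𝒢.mul h g) {h | 𝒢.s h = 𝒢.t g} (𝒢.one (𝒢.t g))).toLinearMap ∘ₗ
      𝒢.evalUnit (𝒢.t g)

theorem inv_one (x : M) : 𝒢.inv (𝒢.one x) = 𝒢.one x := by
  have h := 𝒢.mul_one (𝒢.inv (𝒢.one x))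
  rw [𝒢.s_inv, 𝒢.t_one] at h
  rw [← h, 𝒢.inv_mul, 𝒢.s_one]

/-- The left-invariant vector field `g ↦ TL_g (Ti (α_{s g}))`, where `L_g` is defined on
`{h | t h = s g}`. -/
def leftInvariant (g : G) : 𝒢.Cochain 0 →ₗ[ℝ] TangentSpace I g :=
  tangentCast I (𝒢.mul_one g) ∘ₗ
    (mfderivWithin I I (fun h => 𝒢.mul g h) {h | 𝒢.t h = 𝒢.s g} (𝒢.one (𝒢.s g))).toLinearMap ∘ₗ
      tangentCast I (𝒢.inv_one (𝒢.s g)) ∘ₗ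
        (mfderiv I I 𝒢.inv (𝒢.one (𝒢.s g))).toLinearMap ∘ₗ
          𝒢.evalUnit (𝒢.s g)

/-- `(g₀, …, gₙ₊₁) ↦ (g₀, …, gⱼ gⱼ₊₁, …, gₙ₊₁)`. -/
def contract {n : ℕ} (j : Fin (n + 1)) (g : 𝒢.composable (n + 1)) : 𝒢.composable n :=
  ⟨Fin.contractNth j.castSucc 𝒢.mul g.1, fun i => by
    have h0 : 𝒢.s (g.1 i.castSucc.castSucc) = 𝒢.t (g.1 i.castSucc.succ) := g.2 i.castSucc
    have h1 : 𝒢.s (g.1 i.castSucc.succ) = 𝒢.t (g.1 i.succ.succ) := g.2 i.succ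
    have hc : i.succ.castSucc = i.castSucc.succ := rfl
    simp only [Fin.contractNth, Fin.val_castSucc, Fin.val_succ, hc]
    split_ifs <;> first | omega | simp only [𝒢.s_mul _ _ h0, 𝒢.t_mul _ _ h1, h0, h1]⟩

/-- `(g₀, …, gₙ₊₁) ↦ (g₁, …, gₙ₊₁)`. -/
def dropFirst {n : ℕ} (g : 𝒢.composable (n + 1)) : 𝒢.composable n :=
  ⟨fun i => g.1 i.succ, fun i => g.2 i.succ⟩

/-- `(g₀, …, gₙ₊₁) ↦ (g₀, …, gₙ)`. -/
def dropLast {n : ℕ} (g : 𝒢.composable (n + 1)) : 𝒢.composable n :=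
  ⟨fun i => g.1 i.castSucc, fun i => g.2 i.castSucc⟩

theorem div_contract {n : ℕ} (g : 𝒢.composable (n + 1)) :
    𝒢.mul ((𝒢.contract 0 g).1 0) (𝒢.inv ((𝒢.dropFirst g).1 0)) = g.1 0 := by
  have h : 𝒢.s (g.1 0) = 𝒢.t (g.1 1) := g.2 0
  have h1 : (𝒢.contract 0 g).1 0 = 𝒢.mul (g.1 0) (g.1 1) := rfl
  have h2 : (𝒢.dropFirst g).1 0 = g.1 1 := rfl
  rw [h1, h2, 𝒢.mul_assoc _ _ _ h (𝒢.t_inv _).symm, 𝒢.mul_inv, ← h, 𝒢.mul_one]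

theorem contract_succ_zero {n : ℕ} (i : Fin n) (g : 𝒢.composable (n + 1)) :
    (𝒢.contract i.succ g).1 0 = g.1 0 := by
  simp [contract, Fin.contractNth]

theorem dropLast_zero {n : ℕ} (g : 𝒢.composable (n + 1)) : (𝒢.dropLast g).1 0 = g.1 0 := rfl

/-- The differential `δ : C^{n-1} → C^n`. For `n = 0` it is `δα = ←α + →α`; for `c` of degree
`n ≥ 0` it is
`δc (g₀, …, gₙ₊₁) = - Tm̄ (c (g₀g₁, …, gₙ₊₁), c (g₁, …, gₙ₊₁))
  + ∑_{i=1}^{n} (-1)^{i-1} c (g₀, …, gᵢgᵢ₊₁, …, gₙ₊₁) + (-1)^n c (g₀, …, gₙ)`. -/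
def diff : ∀ n : ℕ, 𝒢.Cochain n →ₗ[ℝ] 𝒢.Cochain (n + 1)
  | 0 => LinearMap.pi fun g : 𝒢.composable 0 =>
      𝒢.leftInvariant (g.1 0) + 𝒢.rightInvariant (g.1 0)
  | n + 1 => LinearMap.pi fun g : 𝒢.composable (n + 1) =>
      -(tangentCast I (𝒢.div_contract g) ∘ₗ
          𝒢.tangentDiv ((𝒢.contract 0 g).1 0) ((𝒢.dropFirst g).1 0) ∘ₗ
            LinearMap.prod (𝒢.evalTuple (𝒢.contract 0 g)) (𝒢.evalTuple (𝒢.dropFirst g)))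
      + ∑ i : Fin n, (-1 : ℝ) ^ (i : ℕ) •
          (tangentCast I (𝒢.contract_succ_zero i g) ∘ₗ 𝒢.evalTuple (𝒢.contract i.succ g))
      + (-1 : ℝ) ^ n • (tangentCast I (𝒢.dropLast_zero g) ∘ₗ 𝒢.evalTuple (𝒢.dropLast g))

/-! ### Subcomplexes and cohomology

`D` is a graded subspace of the space of all sections, e.g. the deformation cochains. -/

/-- The cocycles of `D` in degree `n - 1`. -/
def cocycles (D : ∀ n : ℕ, Submodule ℝ (𝒢.Cochain n)) (n : ℕ) : Submodule ℝ (𝒢.Cochain n) :=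
  D n ⊓ LinearMap.ker (𝒢.diff n)

/-- The coboundaries of `D` in degree `n - 1`. -/
def coboundaries (D : ∀ n : ℕ, Submodule ℝ (𝒢.Cochain n)) : ∀ n : ℕ, Submodule ℝ (𝒢.Cochain n)
  | 0 => ⊥
  | n + 1 => (D n).map (𝒢.diff n)

/-- The cohomology of `D` in degree `n - 1`. -/
abbrev Cohomology (D : ∀ n : ℕ, Submodule ℝ (𝒢.Cochain n)) (n : ℕ) :=
  𝒢.cocycles D n ⧸ (𝒢.coboundaries D n).submoduleOf (𝒢.cocycles D n)

theorem cocycles_mono {D D' : ∀ n : ℕ, Submodule ℝ (𝒢.Cochain n)} (h : ∀ n, D n ≤ D' n) (n : ℕ) :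
    𝒢.cocycles D n ≤ 𝒢.cocycles D' n :=
  inf_le_inf_right _ (h n)

theorem coboundaries_mono {D D' : ∀ n : ℕ, Submodule ℝ (𝒢.Cochain n)} (h : ∀ n, D n ≤ D' n) :
    ∀ n : ℕ, 𝒢.coboundaries D n ≤ 𝒢.coboundaries D' n
  | 0 => le_rfl
  | n + 1 => Submodule.map_mono (h n)

/-- The map in cohomology induced by an inclusion `D ⊆ D'`. -/
def cohomologyMap {D D' : ∀ n : ℕ, Submodule ℝ (𝒢.Cochain n)} (h : ∀ n, D n ≤ D' n) (n : ℕ) :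
    𝒢.Cohomology D n →ₗ[ℝ] 𝒢.Cohomology D' n :=
  Submodule.mapQ _ _ (Submodule.inclusion (𝒢.cocycles_mono h n))
    fun _ hc => 𝒢.coboundaries_mono h n hc

end Deformation

section Morphisms

variable {E₁ H₁ E₁' H₁' E₂ H₂ E₂' H₂' : Type*}
  [NormedAddCommGroup E₁] [NormedSpace ℝ E₁] [TopologicalSpace H₁]
  [NormedAddCommGroup E₁'] [NormedSpace ℝ E₁'] [TopologicalSpace H₁']
  [NormedAddCommGroup E₂] [NormedSpace ℝ E₂] [TopologicalSpace H₂]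
  [NormedAddCommGroup E₂'] [NormedSpace ℝ E₂'] [TopologicalSpace H₂']
  {I₁ : ModelWithCorners ℝ E₁ H₁} {J₁ : ModelWithCorners ℝ E₁' H₁'}
  {I₂ : ModelWithCorners ℝ E₂ H₂} {J₂ : ModelWithCorners ℝ E₂' H₂'}
  {G₁ M₁ G₂ M₂ : Type u}
  [TopologicalSpace G₁] [ChartedSpace H₁ G₁] [IsManifold I₁ ∞ G₁]
  [TopologicalSpace M₁] [ChartedSpace H₁' M₁] [IsManifold J₁ ∞ M₁]
  [TopologicalSpace G₂] [ChartedSpace H₂ G₂] [IsManifold I₂ ∞ G₂]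
  [TopologicalSpace M₂] [ChartedSpace H₂' M₂] [IsManifold J₂ ∞ M₂]

/-- `Φ` is a morphism of Lie groupoids over `f`. -/
structure IsHom (𝒢₁ : LieGroupoid I₁ J₁ G₁ M₁) (𝒢₂ : LieGroupoid I₂ J₂ G₂ M₂)
    (Φ : G₁ → G₂) (f : M₁ → M₂) : Prop where
  smooth : ContMDiff I₁ I₂ ∞ Φ
  smooth_base : ContMDiff J₁ J₂ ∞ f
  map_s : ∀ g, 𝒢₂.s (Φ g) = f (𝒢₁.s g)
  map_t : ∀ g, 𝒢₂.t (Φ g) = f (𝒢₁.t g)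
  map_mul : ∀ g h, 𝒢₁.s g = 𝒢₁.t h → Φ (𝒢₁.mul g h) = 𝒢₂.mul (Φ g) (Φ h)
  map_one : ∀ x, Φ (𝒢₁.one x) = 𝒢₂.one (f x)
  map_inv : ∀ g, Φ (𝒢₁.inv g) = 𝒢₂.inv (Φ g)

/-- An automorphism of a Lie groupoid, together with its inverse. -/
structure Aut (𝒢 : LieGroupoid I₁ J₁ G₁ M₁) where
  toFun : G₁ → G₁
  base : M₁ → M₁
  invFun : G₁ → G₁
  invBase : M₁ → M₁
  isHom : 𝒢.IsHom 𝒢 toFun base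
  isHom_inv : 𝒢.IsHom 𝒢 invFun invBase
  left_inv : ∀ g, invFun (toFun g) = g
  right_inv : ∀ g, toFun (invFun g) = g
  base_left_inv : ∀ x, invBase (base x) = x
  base_right_inv : ∀ x, base (invBase x) = x

variable {𝒢 : LieGroupoid I₁ J₁ G₁ M₁} (Ψ : 𝒢.Aut)

/-- `(g₀, …, gₙ) ↦ (Ψ g₀, …, Ψ gₙ)`. -/
def Aut.mapTuple {n : ℕ} (g : 𝒢.composable n) : 𝒢.composable n :=
  ⟨fun i => Ψ.toFun (g.1 i), fun i => by
    rw [Ψ.isHom.map_s, Ψ.isHom.map_t, g.2 i]⟩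

theorem Aut.inv_one_base (x : M₁) : Ψ.invFun (𝒢.one (Ψ.base x)) = 𝒢.one x := by
  rw [← Ψ.isHom.map_one, Ψ.left_inv]

/-- The pull-back of cochains along an automorphism: in degree `-1`,
`(Ψ^* α)_x = TΨ⁻¹ (α_{f x})` where `f` is the map induced by `Ψ` on `M`; in degrees `≥ 0`,
`(Ψ^* c) (g₀, …, gₙ) = TΨ⁻¹ (c (Ψ g₀, …, Ψ gₙ))`. -/
def Aut.pullback : ∀ n : ℕ, 𝒢.Cochain n →ₗ[ℝ] 𝒢.Cochain n
  | 0 => LinearMap.pi fun x : M₁ =>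
      tangentCast I₁ (Ψ.inv_one_base x) ∘ₗ
        (mfderiv I₁ I₁ Ψ.invFun (𝒢.one (Ψ.base x))).toLinearMap ∘ₗ 𝒢.evalUnit (Ψ.base x)
  | n + 1 => LinearMap.pi fun g : 𝒢.composable n =>
      tangentCast I₁ (Ψ.left_inv (g.1 0)) ∘ₗ
        (mfderiv I₁ I₁ Ψ.invFun (Ψ.toFun (g.1 0))).toLinearMap ∘ₗ 𝒢.evalTuple (Ψ.mapTuple g)

end Morphisms

end LieGroupoid

section FiberOperations

variable {B : Type*} {F : Type*} {V : B → Type*} [∀ x, AddCommGroup (V x)] [∀ x, Module ℝ (V x)]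

/-- Fiberwise multiplication by `r` on the total space of a vector bundle. -/
def fiberSMul (r : ℝ) (w : TotalSpace F V) : TotalSpace F V := ⟨w.proj, r • w.2⟩

theorem fiberSMul_cancel {a b : ℝ} (h : a * b = 1) (w : TotalSpace F V) :
    fiberSMul a (fiberSMul b w) = w := by
  unfold fiberSMul
  rw [smul_smul, h, one_smul]

/-- Fiberwise addition of two points of the total space in the same fiber. -/
def fiberAdd (w w' : TotalSpace F V) (h : w.proj = w'.proj) : TotalSpace F V :=
  ⟨w.proj, w.2 + (h.symm ▸ w'.2 : V w.proj)⟩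

end FiberOperations

/-- A VB-groupoid `(W ⇉ E; G ⇉ M)`: two Lie groupoids and two vector bundles `W → G`, `E → M` such
that the projection, the zero section, the scalar multiplications and the addition
`W ×_G W → W` over `E ×_M E → E` are morphisms of Lie groupoids. (Smoothness of the addition holds
in any smooth vector bundle.) -/
structure VBGroupoid {EG HG EM HM : Type*} [NormedAddCommGroup EG] [NormedSpace ℝ EG]
    [TopologicalSpace HG] [NormedAddCommGroup EM] [NormedSpace ℝ EM] [TopologicalSpace HM]
    (IG : ModelWithCorners ℝ EG HG) (IM : ModelWithCorners ℝ EM HM)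
    {G M : Type u} [TopologicalSpace G] [ChartedSpace HG G] [IsManifold IG ∞ G]
    [TopologicalSpace M] [ChartedSpace HM M] [IsManifold IM ∞ M]
    (FW : Type*) [NormedAddCommGroup FW] [NormedSpace ℝ FW]
    (W : G → Type u) [∀ g, AddCommGroup (W g)] [∀ g, Module ℝ (W g)]
    [∀ g, TopologicalSpace (W g)] [TopologicalSpace (TotalSpace FW W)]
    [FiberBundle FW W] [VectorBundle ℝ FW W] [ContMDiffVectorBundle ∞ FW W IG]
    (FE : Type*) [NormedAddCommGroup FE] [NormedSpace ℝ FE]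
    (E : M → Type u) [∀ x, AddCommGroup (E x)] [∀ x, Module ℝ (E x)]
    [∀ x, TopologicalSpace (E x)] [TopologicalSpace (TotalSpace FE E)]
    [FiberBundle FE E] [VectorBundle ℝ FE E] [ContMDiffVectorBundle ∞ FE E IM] where
  total : LieGroupoid (IG.prod 𝓘(ℝ, FW)) (IM.prod 𝓘(ℝ, FE)) (TotalSpace FW W) (TotalSpace FE E)
  base : LieGroupoid IG IM G M
  proj_hom : total.IsHom base TotalSpace.proj TotalSpace.proj
  zero_hom : base.IsHom total (zeroSection FW W) (zeroSection FE E)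
  smul_hom : ∀ r : ℝ, total.IsHom total (fiberSMul r) (fiberSMul r)
  add_s : ∀ w w' (h : w.proj = w'.proj) (h' : (total.s w).proj = (total.s w').proj),
    total.s (fiberAdd w w' h) = fiberAdd (total.s w) (total.s w') h'
  add_t : ∀ w w' (h : w.proj = w'.proj) (h' : (total.t w).proj = (total.t w').proj),
    total.t (fiberAdd w w' h) = fiberAdd (total.t w) (total.t w') h'
  add_one : ∀ e e' (h : e.proj = e'.proj) (h' : (total.one e).proj = (total.one e').proj),
    total.one (fiberAdd e e' h) = fiberAdd (total.one e) (total.one e') h'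
  add_inv : ∀ w w' (h : w.proj = w'.proj) (h' : (total.inv w).proj = (total.inv w').proj),
    total.inv (fiberAdd w w' h) = fiberAdd (total.inv w) (total.inv w') h'
  add_mul : ∀ w₁ w₁' w₂ w₂' (h₁ : w₁.proj = w₁'.proj) (h₂ : w₂.proj = w₂'.proj)
    (h' : (total.mul w₁ w₂).proj = (total.mul w₁' w₂').proj),
    total.s w₁ = total.t w₂ → total.s w₁' = total.t w₂' →
    total.mul (fiberAdd w₁ w₁' h₁) (fiberAdd w₂ w₂' h₂) =
      fiberAdd (total.mul w₁ w₂) (total.mul w₁' w₂') h'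

namespace VBGroupoid

variable {EG HG EM HM : Type*} [NormedAddCommGroup EG] [NormedSpace ℝ EG]
  [TopologicalSpace HG] [NormedAddCommGroup EM] [NormedSpace ℝ EM] [TopologicalSpace HM]
  {IG : ModelWithCorners ℝ EG HG} {IM : ModelWithCorners ℝ EM HM}
  {G M : Type u} [TopologicalSpace G] [ChartedSpace HG G] [IsManifold IG ∞ G]
  [TopologicalSpace M] [ChartedSpace HM M] [IsManifold IM ∞ M]
  {FW : Type*} [NormedAddCommGroup FW] [NormedSpace ℝ FW]
  {W : G → Type u} [∀ g, AddCommGroup (W g)] [∀ g, Module ℝ (W g)]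
  [∀ g, TopologicalSpace (W g)] [TopologicalSpace (TotalSpace FW W)]
  [FiberBundle FW W] [VectorBundle ℝ FW W] [ContMDiffVectorBundle ∞ FW W IG]
  {FE : Type*} [NormedAddCommGroup FE] [NormedSpace ℝ FE]
  {E : M → Type u} [∀ x, AddCommGroup (E x)] [∀ x, Module ℝ (E x)]
  [∀ x, TopologicalSpace (E x)] [TopologicalSpace (TotalSpace FE E)]
  [FiberBundle FE E] [VectorBundle ℝ FE E] [ContMDiffVectorBundle ∞ FE E IM]
  (V : VBGroupoid IG IM FW W FE E)

/-- The homothety `h_r : W → W`, `r > 0`, as an automorphism of `W ⇉ E`. -/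
def homothety (r : Ioi (0 : ℝ)) : V.total.Aut where
  toFun := fiberSMul (r : ℝ)
  base := fiberSMul (r : ℝ)
  invFun := fiberSMul (r : ℝ)⁻¹
  invBase := fiberSMul (r : ℝ)⁻¹
  isHom := V.smul_hom r
  isHom_inv := V.smul_hom (r : ℝ)⁻¹
  left_inv := fiberSMul_cancel (inv_mul_cancel₀ (ne_of_gt r.2))
  right_inv := fiberSMul_cancel (mul_inv_cancel₀ (ne_of_gt r.2))
  base_left_inv := fiberSMul_cancel (inv_mul_cancel₀ (ne_of_gt r.2))
  base_right_inv := fiberSMul_cancel (mul_inv_cancel₀ (ne_of_gt r.2))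

/-- The action `c ↦ h_r^* c` on cochains of degree `n - 1`. -/
def hpull (r : Ioi (0 : ℝ)) (n : ℕ) : V.total.Cochain n →ₗ[ℝ] V.total.Cochain n :=
  (V.homothety r).pullback n

/-- The space `C^{n-1}_def(W)` of deformation cochains of `W ⇉ E` of degree `n - 1`. -/
abbrev defCochains (n : ℕ) : Submodule ℝ (V.total.Cochain n) := V.total.defCochains n

/-- The space `C^{n-1}_{def,lin}(W)` of linear deformation cochains of degree `n - 1`. -/
def linCochains (n : ℕ) : Submodule ℝ (V.total.Cochain n) where
  carrier := {c | c ∈ V.defCochains n ∧ ∀ r : Ioi (0 : ℝ), V.hpull r n c = c}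
  add_mem' := fun hc hd =>
    ⟨add_mem hc.1 hd.1, fun r => by rw [map_add, hc.2 r, hd.2 r]⟩
  zero_mem' := ⟨zero_mem _, fun r => map_zero _⟩
  smul_mem' := fun a c hc => ⟨Submodule.smul_mem _ a hc.1, fun r => by rw [map_smul, hc.2 r]⟩

theorem linCochains_le (n : ℕ) : V.linCochains n ≤ V.defCochains n := fun _ hc => hc.1

/-- The filter `r → 0`, `r > 0`. -/
def zeroPlus : Filter (Ioi (0 : ℝ)) := comap (fun r => (r : ℝ)) (𝓝 0)

/-- `c₀` is the pointwise limit `lim_{r → 0} r • h_r^* c`. -/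
def IsCorePart {n : ℕ} (c c₀ : V.total.Cochain n) : Prop :=
  ∀ p, Tendsto (fun r : Ioi (0 : ℝ) => (r : ℝ) • V.hpull r n c p) zeroPlus (𝓝 (c₀ p))

/-- `c₁` is the linearization of `c`: the limit `c_core = lim_{r → 0} r • h_r^* c` exists as a
deformation cochain, and `c₁` is the pointwise limit `lim_{r → 0} (h_r^* c - r⁻¹ • c_core)`. -/
def IsLinearization {n : ℕ} (c c₁ : V.total.Cochain n) : Prop :=
  ∃ c₀ ∈ V.defCochains n, V.IsCorePart c c₀ ∧
    ∀ p, Tendsto (fun r : Ioi (0 : ℝ) => V.hpull r n c p - (r : ℝ)⁻¹ • c₀ p) zeroPlus (𝓝 (c₁ p))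

end VBGroupoid

end

/-! In a bundle chart of `W` the homothety `h_r` is `(x, v) ↦ (x, r v)`. If `(a, b)` are the base
and fiber components of a cochain in such a chart, evaluated at the arguments scaled by `r`, then
`h_r^* c` has components `(a(r), r⁻¹ b(r))`. Scaling makes sense for every real `r`, so `a` and `b`
are smooth across `r = 0`, and the expansion starts with `r⁻¹ (0, b(0)) + (a(0), b'(0))`. The two
coefficients are the core and the linear part. They are a value and a parameter derivative of smooth
functions, hence smooth (`exists_core_linear_parts`). The groupoid structure enters only through the
equivariance of the foot map and the invariance of composable tuples under scaling.

The rest is formal. The source condition is linear in the values of a cochain, so it survives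
pointwise limits. The differential commutes with pull-back along automorphisms (`diff_pullback`) and
with pointwise limits (`TendstoPointwise.diff`), so linearization is a cochain map. Replacing `r` by
`r μ` in the limits shows that the linear part is invariant (`IsLinearization.hpull_eq`), and linear
cochains are their own linearization. A cochain retraction gives the direct sum and the injection in
cohomology.

For the complex itself the delicate object is the tangent map of division, a derivative within `{s a
= s b}`. It is meaningful only on pairs `(u, v)` with `Ts u = Ts v`. Since `s` is a submersion,
every such pair is the velocity of a pair of curves with equal sources (`exists_curve_pair`).
Identities such as `divL_divL`, which yields `δ² = 0`, thus follow by differentiating groupoid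
identities along curves. Smoothness comes from a local extension of division to an open set
(`contMDiffOn_divL`). -/

/-! ### Smoothness of derivatives in a parameter. -/

section ParameterDerivative

variable {E F : Type*} [NormedAddCommGroup E] [NormedSpace ℝ E] [NormedAddCommGroup F]
  [NormedSpace ℝ F]

/-- The derivative at `0` in the direction of the first factor of a smooth function on `ℝ × S` is
smooth on `S`, for an arbitrary set `S`. -/
theorem ContDiffWithinAt.deriv_param {f : ℝ × E → F} {S : Set E} {x₀ : E} (hx₀ : x₀ ∈ S)
    (hf : ContDiffWithinAt ℝ ∞ f (univ ×ˢ S) (0, x₀)) :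
    ContDiffWithinAt ℝ ∞ (fun x => deriv (fun r => f (r, x)) 0) S x₀ := by
  rw [contDiffWithinAt_infty]
  intro n
  -- One order of differentiability is spent on the derivative.
  have hn : ContDiffWithinAt ℝ ((n : WithTop ℕ∞) + 1) f (univ ×ˢ S) (0, x₀) :=
    hf.of_le (by exact_mod_cast le_top)
  obtain ⟨u, hu, -, -, f', hf', hsm⟩ :=
    (contDiffWithinAt_succ_iff_hasFDerivWithinAt' (by simp)).1 hn
  have hins : insert ((0 : ℝ), x₀) (univ ×ˢ S) = univ ×ˢ S :=
    insert_eq_of_mem ⟨mem_univ _, hx₀⟩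
  rw [hins] at hu
  have hι : ContDiffWithinAt ℝ n (fun x : E => ((0 : ℝ), x)) S x₀ := by fun_prop
  have hmaps : MapsTo (fun x : E => ((0 : ℝ), x)) S (univ ×ˢ S) := fun x hx => ⟨mem_univ _, hx⟩
  -- Derivatives within `univ ×ˢ S` need not be unique, so `f'` is only one of them. Its value on
  -- `(1, 0)` is nevertheless forced, because the whole line `r ↦ (r, x)` stays in the set.
  have hval : ∀ x ∈ S, ((0 : ℝ), x) ∈ u → deriv (fun r => f (r, x)) 0 = f' (0, x) (1, 0) := by
    intro x hx hxu
    have h1 : HasDerivAt (fun r : ℝ => (r, x)) ((1 : ℝ), (0 : E)) 0 :=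
      (hasDerivAt_id 0).prodMk (hasDerivAt_const _ _)
    exact ((hf' _ hxu).comp_hasDerivAt_of_eq (0 : ℝ) h1
      (Eventually.of_forall fun r => ⟨mem_univ r, hx⟩) rfl).deriv
  have h := (hsm.comp x₀ hι hmaps).clm_apply
    (contDiffWithinAt_const (c := ((1 : ℝ), (0 : E))))
  refine h.congr_of_eventuallyEq ?_ ?_
  · have := hι.continuousWithinAt.tendsto_nhdsWithin hmaps hu
    filter_upwards [this, self_mem_nhdsWithin] with x hxu hx
    exact hval x hx hxu
  · exact hval x₀ hx₀ (mem_of_mem_nhdsWithin (hmaps hx₀) hu)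

variable {E' H' : Type*} [NormedAddCommGroup E'] [NormedSpace ℝ E'] [TopologicalSpace H']
  {J : ModelWithCorners ℝ E' H'} {N : Type*} [TopologicalSpace N] [ChartedSpace H' N]

theorem ContMDiffWithinAt.deriv_param {f : ℝ × N → F} {S : Set N} {x₀ : N} (hx₀ : x₀ ∈ S)
    (hf : ContMDiffWithinAt (𝓘(ℝ, ℝ).prod J) 𝓘(ℝ, F) ∞ f (univ ×ˢ S) (0, x₀)) :
    ContMDiffWithinAt J 𝓘(ℝ, F) ∞ (fun x => deriv (fun r => f (r, x)) 0) S x₀ := by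
  rw [contMDiffWithinAt_iff] at hf
  have hset : (extChartAt (𝓘(ℝ, ℝ).prod J) ((0 : ℝ), x₀)).symm ⁻¹' (univ ×ˢ S) ∩
      range (𝓘(ℝ, ℝ).prod J) = univ ×ˢ ((extChartAt J x₀).symm ⁻¹' S ∩ range J) := by
    rw [ModelWithCorners.range_prod]
    ext ⟨r, y⟩
    simp only [extChartAt_prod, mem_inter_iff, mem_preimage, mem_prod, mem_univ, true_and,
      PartialEquiv.prod_symm, PartialEquiv.prod_coe, modelWithCornersSelf_coe, range_id]
  have h := hf.2
  rw [hset] at h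
  have h' := h.deriv_param (f := (extChartAt 𝓘(ℝ, F) (f (0, x₀)) ∘ f ∘
    (extChartAt (𝓘(ℝ, ℝ).prod J) ((0 : ℝ), x₀)).symm)) (x₀ := extChartAt J x₀ x₀)
    (by simpa using hx₀)
  have hd : ContDiffWithinAt ℝ ∞ ((fun x => deriv (fun r => f (r, x)) 0) ∘ (extChartAt J x₀).symm)
      ((extChartAt J x₀).symm ⁻¹' S ∩ range J) (extChartAt J x₀ x₀) := h'
  have hm : ContMDiffWithinAt 𝓘(ℝ, E') 𝓘(ℝ, F) ∞
    ((fun x => deriv (fun r => f (r, x)) 0) ∘ (extChartAt J x₀).symm)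
      ((extChartAt J x₀).symm ⁻¹' S ∩ range J) (extChartAt J x₀ x₀) :=
    hd.contMDiffWithinAt
  rw [contMDiffWithinAt_iff]
  refine ⟨?_, hd⟩
  have hc : ContinuousWithinAt (extChartAt J x₀) S x₀ :=
    (continuousAt_extChartAt x₀).continuousWithinAt
  have hmaps : MapsTo (extChartAt J x₀) (S ∩ (extChartAt J x₀).source)
      ((extChartAt J x₀).symm ⁻¹' S ∩ range J) := fun x hx =>
    ⟨by rw [mem_preimage, (extChartAt J x₀).left_inv hx.2]; exact hx.1,
      extChartAt_target_subset_range x₀ ((extChartAt J x₀).map_source hx.2)⟩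
  have hcomp := hm.continuousWithinAt.comp
    (hc.mono (inter_subset_left (t := (extChartAt J x₀).source))) hmaps
  have hcongr : ContinuousWithinAt (fun x => deriv (fun r => f (r, x)) 0)
      (S ∩ (extChartAt J x₀).source) x₀ :=
    hcomp.congr (fun x hx => by
      simp only [Function.comp_apply, (extChartAt J x₀).left_inv hx.2]) (by simp)
  exact (continuousWithinAt_inter (extChartAt_source_mem_nhds x₀)).1 hcongr

end ParameterDerivative

section Pi

variable {E H : Type*} [NormedAddCommGroup E] [NormedSpace ℝ E] [TopologicalSpace H]
  {I : ModelWithCorners ℝ E H} {G : Type*} [TopologicalSpace G] [ChartedSpace H G]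
  {E' H' : Type*} [NormedAddCommGroup E'] [NormedSpace ℝ E'] [TopologicalSpace H']
  {J : ModelWithCorners ℝ E' H'} {N : Type*} [TopologicalSpace N] [ChartedSpace H' N]

theorem ContMDiffWithinAt.pi_manifold {n : ℕ} {f : N → Fin n → G} {S : Set N} {x : N}
    (hf : ∀ i, ContMDiffWithinAt J I ∞ (fun y => f y i) S x) :
    ContMDiffWithinAt J (ModelWithCorners.pi fun _ : Fin n => I) ∞ f S x := by
  rw [contMDiffWithinAt_iff]
  refine ⟨continuousWithinAt_pi.2 fun i => (hf i).continuousWithinAt, ?_⟩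
  rw [contDiffWithinAt_pi]
  exact fun i => (contMDiffWithinAt_iff.1 (hf i)).2

end Pi

/-! ### Local transport between the fibers of a submersion. -/

section Submersion

variable {E H E' H' : Type*} [NormedAddCommGroup E] [NormedSpace ℝ E]
  [TopologicalSpace H] [NormedAddCommGroup E'] [NormedSpace ℝ E'] [TopologicalSpace H']
  {I : ModelWithCorners ℝ E H} {J : ModelWithCorners ℝ E' H'}
  {G M : Type*} [TopologicalSpace G] [ChartedSpace H G]
  [TopologicalSpace M] [ChartedSpace H' M]

/-- Near a point `b`, the fibers of a submersion `f` can be transported smoothly: there is a map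
`(x, g) ↦ Θ (x, g)` moving `g` to the fiber over `x`, which fixes `g` if `x = f g`. -/
theorem Manifold.IsSubmersion.exists_transport [I.Boundaryless] {f : G → M}
    (hf : Manifold.IsSubmersion I J ∞ f) (b : G) :
    ∃ Θ : M × G → G, (∀ᶠ p in 𝓝 (f b, b), ContMDiffAt (J.prod I) I ∞ Θ p) ∧
      (∀ᶠ p in 𝓝 (f b, b), f (Θ p) = p.1) ∧ ∀ᶠ g in 𝓝 b, Θ (f g, g) = g := by
  obtain ⟨F, _, _, h⟩ := hf.isSubmersionAt b
  have hφ := h.domChart_mem_maximalAtlas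
  have hψ := h.codChart_mem_maximalAtlas
  have hw := h.writtenInCharts
  have hsrc := h.source_subset_preimage_source
  have hbφ := h.mem_domChart_source
  have hbψ := h.mem_codChart_source
  generalize h.domChart = φ at *
  generalize h.codChart = ψ at *
  generalize h.equiv = e at *
  have hfg : ∀ g ∈ φ.source, ψ.extend J (f g) = (e (φ.extend I g)).1 := by
    intro g hg
    have := hw ((φ.extend I).map_source (by rwa [φ.extend_source]))
    simpa only [Function.comp_apply, φ.extend_left_inv hg] using this
  -- In the two charts `f` is the projection to the first factor of `E' × F`: the `F`-coordinate of
  -- `g` is kept and the first coordinate is replaced by that of the target point.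
  let ι : M × G → E := fun p => e.symm (ψ.extend J p.1, (e (φ.extend I p.2)).2)
  have hιb : ∀ g ∈ φ.source, ι (f g, g) = φ.extend I g := by
    intro g hg
    change e.symm (ψ.extend J (f g), _) = _
    rw [hfg g hg]
    exact e.symm_apply_apply _
  have hι : ∀ p : M × G, p.1 ∈ ψ.source → p.2 ∈ φ.source →
      ContMDiffAt (J.prod I) 𝓘(ℝ, E) ∞ ι p := by
    intro p hp₁ hp₂
    have h1 : ContMDiffAt (J.prod I) 𝓘(ℝ, E') ∞ (fun p : M × G => ψ.extend J p.1) p :=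
      (J.contMDiff.contMDiffAt.comp _ (contMDiffAt_of_mem_maximalAtlas hψ hp₁)).comp
        p contMDiffAt_fst
    have h2 : ContMDiffAt (J.prod I) 𝓘(ℝ, E) ∞ (fun p : M × G => φ.extend I p.2) p :=
      (I.contMDiff.contMDiffAt.comp _ (contMDiffAt_of_mem_maximalAtlas hφ hp₂)).comp
        p contMDiffAt_snd
    have h3 : ContMDiffAt (J.prod I) 𝓘(ℝ, F) ∞ (fun p : M × G => (e (φ.extend I p.2)).2) p :=
      (((ContinuousLinearMap.snd ℝ E' F).comp
        (e : E →L[ℝ] E' × F)).contMDiff.contMDiffAt).comp p h2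
    exact ((e.symm : E' × F →L[ℝ] E).contMDiff.contMDiffAt).comp p (h1.prodMk_space h3)
  have htar : (φ.extend I).target ∈ 𝓝 (φ.extend I b) :=
    φ.isOpen_extend_target.mem_nhds ((φ.extend I).map_source (by rwa [φ.extend_source]))
  have hev : ∀ᶠ p in 𝓝 (f b, b), ι p ∈ (φ.extend I).target := by
    refine (hι _ hbψ hbφ).continuousAt ?_
    rw [hιb b hbφ]
    exact htar
  have hp1 : ∀ᶠ p : M × G in 𝓝 (f b, b), p.1 ∈ ψ.source :=
    continuousAt_fst (ψ.open_source.mem_nhds hbψ)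
  have hp2 : ∀ᶠ p : M × G in 𝓝 (f b, b), p.2 ∈ φ.source :=
    continuousAt_snd (φ.open_source.mem_nhds hbφ)
  refine ⟨fun p => (φ.extend I).symm (ι p), ?_, ?_, ?_⟩
  · filter_upwards [hp1, hp2, hev] with p hp₁ hp₂ hp
    refine ContMDiffAt.comp p ((contMDiffOn_extend_symm hφ).contMDiffAt ?_) (hι p hp₁ hp₂)
    rw [← φ.extend_target']
    exact φ.isOpen_extend_target.mem_nhds hp
  · filter_upwards [hev, hp1] with p hp hp1
    have hs : (φ.extend I).symm (ι p) ∈ φ.source := by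
      have := (φ.extend I).map_target hp
      rwa [φ.extend_source] at this
    have hE := hw hp
    have : ψ.extend J (f ((φ.extend I).symm (ι p))) = ψ.extend J p.1 := by
      refine hE.trans ?_
      exact congrArg Prod.fst (e.apply_symm_apply _)
    refine (ψ.extend J).injOn ?_ ?_ this
    · rw [ψ.extend_source]; exact hsrc hs
    · rwa [ψ.extend_source]
  · filter_upwards [φ.open_source.mem_nhds hbφ] with g hg
    rw [hιb g hg, φ.extend_left_inv hg]

end Submersion

/-! ### Tangent vectors as velocities of curves. -/

section Velocity

variable {E H E' H' E'' H'' : Type*} [NormedAddCommGroup E] [NormedSpace ℝ E]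
  [TopologicalSpace H] [NormedAddCommGroup E'] [NormedSpace ℝ E'] [TopologicalSpace H']
  [NormedAddCommGroup E''] [NormedSpace ℝ E''] [TopologicalSpace H'']
  {I : ModelWithCorners ℝ E H} {J : ModelWithCorners ℝ E' H'} {K : ModelWithCorners ℝ E'' H''}
  {G M N : Type*} [TopologicalSpace G] [ChartedSpace H G]
  [TopologicalSpace M] [ChartedSpace H' M] [TopologicalSpace N] [ChartedSpace H'' N]

variable (I) in
/-- The curve `γ` passes through `x` at time `0` with velocity `v`. -/
def HasVelocity (γ : ℝ → G) (x : G) (v : E) : Prop :=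
  γ 0 = x ∧ HasMFDerivAt 𝓘(ℝ, ℝ) I γ 0 (ContinuousLinearMap.toSpanSingleton ℝ v)

variable (I J) in
/-- The derivative of `f` at `x` as a map between the model spaces. -/
noncomputable def modelDeriv (f : G → M) (x : G) : E →L[ℝ] E' := mfderiv I J f x

namespace HasVelocity

theorem unique {γ : ℝ → G} {x : G} {v w : E} (hv : HasVelocity I γ x v)
    (hw : HasVelocity I γ x w) : v = w := by
  have h : ContinuousLinearMap.toSpanSingleton ℝ v = ContinuousLinearMap.toSpanSingleton ℝ w :=
    hasMFDerivAt_unique hv.2 hw.2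
  simpa using congrArg (fun L : ℝ →L[ℝ] E => L 1) h

theorem congr {γ γ' : ℝ → G} {x : G} {v : E} (hv : HasVelocity I γ x v)
    (h : ∀ᶠ τ in 𝓝 0, γ' τ = γ τ) : HasVelocity I γ' x v :=
  ⟨h.self_of_nhds.trans hv.1, hv.2.congr_of_eventuallyEq h⟩

theorem continuousAt {γ : ℝ → G} {x : G} {v : E} (hv : HasVelocity I γ x v) : ContinuousAt γ 0 :=
  hv.2.continuousAt

theorem eventually {γ : ℝ → G} {x : G} {v : E} (hv : HasVelocity I γ x v) {p : G → Prop}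
    (hp : ∀ᶠ y in 𝓝 x, p y) : ∀ᶠ τ in 𝓝 0, p (γ τ) :=
  hv.continuousAt.eventually (hv.1.symm ▸ hp)

theorem const (x : G) : HasVelocity I (fun _ : ℝ => x) x (0 : E) :=
  ⟨rfl, (congrArg (fun L : ℝ →L[ℝ] E => HasMFDerivAt 𝓘(ℝ, ℝ) I (fun _ : ℝ => x) 0 L)
    (ContinuousLinearMap.toSpanSingleton_zero (M₁ := E) ℝ)).mpr (hasMFDerivAt_const x (0 : ℝ))⟩

/-- Derivatives within `S` may fail to be unique, but on the velocity of a curve lying in `S` near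
time `0` the value is pinned down by the chain rule. This is what makes `mfderivWithin` on fiber
products computable. -/
theorem comp_within {γ : ℝ → G} {x : G} {v : E} (hv : HasVelocity I γ x v) {f : G → M} {S : Set G}
    (hf : MDifferentiableWithinAt I J f S x) (hS : ∀ᶠ τ in 𝓝 0, γ τ ∈ S) :
    HasVelocity J (fun τ => f (γ τ)) (f x) (mfderivWithin I J f S x v) := by
  obtain ⟨rfl, hγ⟩ := hv
  refine ⟨rfl, ?_⟩
  have h := (hf.hasMFDerivWithinAt.comp (0 : ℝ) (hγ.hasMFDerivWithinAt (s := γ ⁻¹' S))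
    subset_rfl).hasMFDerivAt hS
  have hL : (mfderivWithin I J f S (γ 0) : E →L[ℝ] E').comp
      (ContinuousLinearMap.toSpanSingleton ℝ v) =
        ContinuousLinearMap.toSpanSingleton ℝ ((mfderivWithin I J f S (γ 0) : E →L[ℝ] E') v) :=
    ContinuousLinearMap.comp_toSpanSingleton _ _
  rw [← hL]
  exact h

theorem comp {γ : ℝ → G} {x : G} {v : E} (hv : HasVelocity I γ x v) {f : G → M}
    (hf : MDifferentiableAt I J f x) :
    HasVelocity J (fun τ => f (γ τ)) (f x) (modelDeriv I J f x v) := by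
  have h := hv.comp_within (S := univ) hf.mdifferentiableWithinAt (by simp)
  rwa [mfderivWithin_univ] at h

theorem prodMk {γ : ℝ → G} {x : G} {v : E} (hv : HasVelocity I γ x v) {γ' : ℝ → M} {x' : M}
    {v' : E'} (hv' : HasVelocity J γ' x' v') :
    HasVelocity (I.prod J) (fun τ => (γ τ, γ' τ)) (x, x') (v, v') := by
  refine ⟨by simp [hv.1, hv'.1], ?_⟩
  exact hv.2.prodMk hv'.2

/-- A straight line in the preferred chart at `x` works: the inverse of that chart has the identity
as derivative at the image of `x`. -/
theorem exists_curve [IsManifold I ∞ G] [I.Boundaryless] (x : G) (v : E) :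
    ∃ γ : ℝ → G, HasVelocity I γ x v := by
  have : IsManifold I 1 G := IsManifold.of_le (n := ∞) (by norm_cast)
  have h1 : HasVelocity 𝓘(ℝ, E) (fun τ : ℝ => extChartAt I x x + τ • v) (extChartAt I x x) v := by
    have h : HasDerivAt (fun τ : ℝ => extChartAt I x x + τ • v) v 0 := by
      simpa using ((hasDerivAt_id (0 : ℝ)).smul_const v).const_add (extChartAt I x x)
    exact ⟨by simp, h.hasFDerivAt.hasMFDerivAt⟩
  have h2 := h1.comp_within (mdifferentiableWithinAt_extChartAt_symm (I := I)
    (mem_extChartAt_target x)) (by simp [I.range_eq_univ])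
  rw [mfderivWithin_range_extChartAt_symm, extChartAt_to_inv] at h2
  exact ⟨_, h2⟩

/-- Transport any curve `γ` with velocity `v` into the fibers over `η`. The velocity remains `v`:
`(η, γ)` and `(f ∘ γ, γ)` have the same velocity, and transporting the second pair gives `γ` back.
-/
theorem exists_lift [IsManifold I ∞ G] [I.Boundaryless] {f : G → M}
    (hf : Manifold.IsSubmersion I J ∞ f) {b : G} {v : E} {η : ℝ → M}
    (hη : HasVelocity J η (f b) (modelDeriv I J f b v)) :
    ∃ γ : ℝ → G, HasVelocity I γ b v ∧ ∀ᶠ τ in 𝓝 0, f (γ τ) = η τ := by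
  obtain ⟨Θ, hΘ, h1, h2⟩ := hf.exists_transport b
  obtain ⟨γ, hγ⟩ := exists_curve (I := I) b v
  have hΘ' : MDifferentiableAt (J.prod I) I Θ (f b, b) :=
    hΘ.self_of_nhds.mdifferentiableAt (by simp)
  have hfb : MDifferentiableAt I J f b := (hf.contMDiff b).mdifferentiableAt (by simp)
  have hΘb : Θ (f b, b) = b := h2.self_of_nhds
  have hA := (hη.prodMk hγ).comp hΘ'
  have hB := ((hγ.comp hfb).prodMk hγ).comp hΘ'
  have hC := hγ.congr (γ' := fun τ => Θ (f (γ τ), γ τ)) (hγ.eventually h2)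
  rw [hΘb] at hA hB
  refine ⟨fun τ => Θ (η τ, γ τ), ?_, (hη.prodMk hγ).eventually h1⟩
  rw [← hB.unique hC]
  exact hA

end HasVelocity
end Velocity

/-! ### The tangent map of the division map. -/

namespace LieGroupoid

section Tangent

variable {E H E' H' : Type*} [NormedAddCommGroup E] [NormedSpace ℝ E]
  [TopologicalSpace H] [NormedAddCommGroup E'] [NormedSpace ℝ E'] [TopologicalSpace H']
  {I : ModelWithCorners ℝ E H} {J : ModelWithCorners ℝ E' H'}
  {G M : Type u} [TopologicalSpace G] [ChartedSpace H G] [IsManifold I ∞ G]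
  [TopologicalSpace M] [ChartedSpace H' M] [IsManifold J ∞ M]
  (𝒢 : LieGroupoid I J G M)

/-! ### Groupoid algebra -/

theorem mul_mul_inv_cancel {g h : G} (hgh : 𝒢.s g = 𝒢.t h) :
    𝒢.mul (𝒢.mul g h) (𝒢.inv h) = g := by
  rw [𝒢.mul_assoc _ _ _ hgh (𝒢.t_inv _).symm, 𝒢.mul_inv, ← hgh, 𝒢.mul_one]

theorem inv_mul_mul_cancel {g h : G} (hgh : 𝒢.s g = 𝒢.t h) :
    𝒢.mul (𝒢.inv g) (𝒢.mul g h) = h := by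
  rw [← 𝒢.mul_assoc _ _ _ (𝒢.s_inv _) hgh, 𝒢.inv_mul, hgh, 𝒢.one_mul]

theorem inv_inv (g : G) : 𝒢.inv (𝒢.inv g) = g := by
  have h := 𝒢.inv_mul_mul_cancel (g := 𝒢.inv g) (h := g) (𝒢.s_inv g)
  rw [𝒢.inv_mul, ← 𝒢.t_inv, ← 𝒢.s_inv, 𝒢.mul_one] at h
  exact h

theorem mul_inv_mul_cancel {g h : G} (hgh : 𝒢.s g = 𝒢.s h) :
    𝒢.mul (𝒢.mul g (𝒢.inv h)) h = g := by
  have := 𝒢.mul_mul_inv_cancel (g := g) (h := 𝒢.inv h) (by rw [𝒢.t_inv, hgh])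
  rwa [𝒢.inv_inv] at this

theorem inv_mul_rev {g h : G} (hgh : 𝒢.s g = 𝒢.t h) :
    𝒢.inv (𝒢.mul g h) = 𝒢.mul (𝒢.inv h) (𝒢.inv g) := by
  have h1 := 𝒢.inv_mul_mul_cancel (g := 𝒢.mul g h) (h := 𝒢.mul (𝒢.inv h) (𝒢.inv g))
    (by rw [𝒢.s_mul _ _ hgh, 𝒢.t_mul _ _ (by rw [𝒢.s_inv, 𝒢.t_inv, hgh]), 𝒢.t_inv])
  rw [← 𝒢.mul_assoc _ (𝒢.inv h) _ (by rw [𝒢.s_mul _ _ hgh, 𝒢.t_inv])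
    (by rw [𝒢.s_inv, 𝒢.t_inv, hgh]), 𝒢.mul_mul_inv_cancel hgh, 𝒢.mul_inv] at h1
  have h2 := 𝒢.mul_one (𝒢.inv (𝒢.mul g h))
  rw [𝒢.s_inv, 𝒢.t_mul _ _ hgh] at h2
  rw [← h2, h1]

theorem s_div {a b : G} (h : 𝒢.s a = 𝒢.s b) : 𝒢.s (𝒢.mul a (𝒢.inv b)) = 𝒢.t b := by
  rw [𝒢.s_mul _ _ (by rw [𝒢.t_inv, h]), 𝒢.s_inv]

/-- The identity behind `δ² = 0`; its derivative is `divL_divL`. -/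
theorem div_div {a b c : G} (hac : 𝒢.s a = 𝒢.s c) (hbc : 𝒢.s b = 𝒢.s c) :
    𝒢.mul (𝒢.mul a (𝒢.inv c)) (𝒢.inv (𝒢.mul b (𝒢.inv c))) = 𝒢.mul a (𝒢.inv b) := by
  rw [𝒢.inv_mul_rev (by rw [𝒢.t_inv, hbc]), 𝒢.inv_inv, ← 𝒢.mul_assoc _ c _
    (𝒢.s_div hac) (by rw [𝒢.t_inv, hbc]), 𝒢.mul_inv_mul_cancel hac]

/-! ### Tangent maps of the structure maps -/

theorem contMDiff_s : ContMDiff I J ∞ 𝒢.s := 𝒢.submersion_s.contMDiff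

theorem contMDiff_t : ContMDiff I J ∞ 𝒢.t := 𝒢.submersion_t.contMDiff

/-- The tangent map of the source map. -/
noncomputable def tangentS (g : G) : E →L[ℝ] E' := modelDeriv I J 𝒢.s g

/-- The tangent map of the target map. -/
noncomputable def tangentT (g : G) : E →L[ℝ] E' := modelDeriv I J 𝒢.t g

/-- `tangentDiv` as a continuous linear map between the model spaces. -/
noncomputable def divL (a b : G) : E × E →L[ℝ] E :=
  mfderivWithin (I.prod I) I (fun p : G × G => 𝒢.mul p.1 (𝒢.inv p.2))
    {p | 𝒢.s p.1 = 𝒢.s p.2} (a, b)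

theorem contMDiffOn_div : ContMDiffOn (I.prod I) I ∞ (fun p : G × G => 𝒢.mul p.1 (𝒢.inv p.2))
    {p | 𝒢.s p.1 = 𝒢.s p.2} :=
  𝒢.smooth_mul.comp (f := fun p : G × G => (p.1, 𝒢.inv p.2))
    (contMDiff_fst.prodMk (𝒢.smooth_inv.comp contMDiff_snd)).contMDiffOn
    fun p hp => by simpa [𝒢.t_inv] using hp

variable {𝒢}

theorem velocity_s {γ : ℝ → G} {a : G} {u : E} (hu : HasVelocity I γ a u) :
    HasVelocity J (fun τ => 𝒢.s (γ τ)) (𝒢.s a) (𝒢.tangentS a u) :=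
  hu.comp ((𝒢.contMDiff_s a).mdifferentiableAt (by simp))

theorem velocity_t {γ : ℝ → G} {a : G} {u : E} (hu : HasVelocity I γ a u) :
    HasVelocity J (fun τ => 𝒢.t (γ τ)) (𝒢.t a) (𝒢.tangentT a u) :=
  hu.comp ((𝒢.contMDiff_t a).mdifferentiableAt (by simp))

/-- This determines `divL` on compatible pairs. Later identities for it arise by computing the
velocity of one curve of arrows in two ways. -/
theorem velocity_div {γ η : ℝ → G} {a b : G} {u v : E} (hu : HasVelocity I γ a u)
    (hv : HasVelocity I η b v) (h : ∀ᶠ τ in 𝓝 0, 𝒢.s (γ τ) = 𝒢.s (η τ)) :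
    HasVelocity I (fun τ => 𝒢.mul (γ τ) (𝒢.inv (η τ))) (𝒢.mul a (𝒢.inv b))
      (𝒢.divL a b (u, v)) := by
  have hab : 𝒢.s a = 𝒢.s b := by rw [← hu.1, ← hv.1]; exact h.self_of_nhds
  exact (hu.prodMk hv).comp_within
    ((𝒢.contMDiffOn_div (a, b) hab).mdifferentiableWithinAt (by simp)) h

variable [I.Boundaryless]

theorem exists_lift_curve {γ : ℝ → G} {a b : G} {u v : E} (hu : HasVelocity I γ a u)
    (hab : 𝒢.s a = 𝒢.s b) (huv : 𝒢.tangentS a u = 𝒢.tangentS b v) :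
    ∃ η : ℝ → G, HasVelocity I η b v ∧ ∀ᶠ τ in 𝓝 0, 𝒢.s (γ τ) = 𝒢.s (η τ) := by
  have h := velocity_s (𝒢 := 𝒢) hu
  rw [hab, huv] at h
  obtain ⟨η, hη, hs⟩ := HasVelocity.exists_lift 𝒢.submersion_s h
  exact ⟨η, hη, hs.mono fun τ hτ => hτ.symm⟩

theorem exists_curve_pair {a b : G} {u v : E} (hab : 𝒢.s a = 𝒢.s b)
    (huv : 𝒢.tangentS a u = 𝒢.tangentS b v) :
    ∃ γ η : ℝ → G, HasVelocity I γ a u ∧ HasVelocity I η b v ∧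
      ∀ᶠ τ in 𝓝 0, 𝒢.s (γ τ) = 𝒢.s (η τ) := by
  obtain ⟨γ, hγ⟩ := HasVelocity.exists_curve (I := I) a u
  obtain ⟨η, hη, hs⟩ := exists_lift_curve hγ hab huv
  exact ⟨γ, η, hγ, hη, hs⟩

theorem tangentS_divL {a b : G} {u v : E} (hab : 𝒢.s a = 𝒢.s b)
    (huv : 𝒢.tangentS a u = 𝒢.tangentS b v) :
    𝒢.tangentS (𝒢.mul a (𝒢.inv b)) (𝒢.divL a b (u, v)) = 𝒢.tangentT b v := by
  obtain ⟨γ, η, hγ, hη, h⟩ := exists_curve_pair hab huv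
  have h1 := velocity_s (𝒢 := 𝒢) (velocity_div hγ hη h)
  rw [𝒢.s_div hab] at h1
  exact h1.unique ((velocity_t hη).congr (h.mono fun τ hτ => 𝒢.s_div hτ))

theorem divL_divL {a b c : G} {u v w : E} (hac : 𝒢.s a = 𝒢.s c) (hbc : 𝒢.s b = 𝒢.s c)
    (huw : 𝒢.tangentS a u = 𝒢.tangentS c w) (hvw : 𝒢.tangentS b v = 𝒢.tangentS c w) :
    𝒢.divL (𝒢.mul a (𝒢.inv c)) (𝒢.mul b (𝒢.inv c))
      (𝒢.divL a c (u, w), 𝒢.divL b c (v, w)) = 𝒢.divL a b (u, v) := by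
  obtain ⟨γ, ζ, hγ, hζ, h1⟩ := exists_curve_pair hac huw
  -- The third curve is lifted over the source of `ζ`, so all three curves share their sources.
  obtain ⟨η, hη, h2⟩ := exists_lift_curve hζ hbc.symm hvw.symm
  have h3 := velocity_div (velocity_div hγ hζ h1)
    (velocity_div hη hζ (h2.mono fun τ hτ => hτ.symm)) (by
      filter_upwards [h1, h2] with τ h1 h2
      rw [𝒢.s_div h1, 𝒢.s_div h2.symm])
  rw [𝒢.div_div hac hbc] at h3
  refine h3.unique ((velocity_div hγ hη ?_).congr ?_)
  · filter_upwards [h1, h2] with τ h1 h2 using h1.trans h2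
  · filter_upwards [h1, h2] with τ h1 h2 using 𝒢.div_div h1 h2.symm

/-- Morphisms of Lie groupoids commute with the tangent maps of the division maps. -/
theorem modelDeriv_divL {Φ : G → G} {f : M → M} (hΦ : 𝒢.IsHom 𝒢 Φ f) {a b : G} {u v : E}
    (hab : 𝒢.s a = 𝒢.s b) (huv : 𝒢.tangentS a u = 𝒢.tangentS b v) :
    modelDeriv I I Φ (𝒢.mul a (𝒢.inv b)) (𝒢.divL a b (u, v)) =
      𝒢.divL (Φ a) (Φ b) (modelDeriv I I Φ a u, modelDeriv I I Φ b v) := by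
  have hd : ∀ g, MDifferentiableAt I I Φ g := fun g => (hΦ.smooth g).mdifferentiableAt (by simp)
  have hdiv : ∀ a b, 𝒢.s a = 𝒢.s b → Φ (𝒢.mul a (𝒢.inv b)) = 𝒢.mul (Φ a) (𝒢.inv (Φ b)) :=
    fun a b h => by rw [hΦ.map_mul _ _ (by rw [𝒢.t_inv, h]), hΦ.map_inv]
  obtain ⟨γ, η, hγ, hη, h⟩ := exists_curve_pair hab huv
  have h1 := (velocity_div hγ hη h).comp (hd _)
  have h2 := velocity_div (𝒢 := 𝒢) (hγ.comp (hd _)) (hη.comp (hd _))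
    (h.mono fun τ hτ => by rw [hΦ.map_s, hΦ.map_s, hτ])
  rw [hdiv a b hab] at h1
  exact h1.unique (h2.congr (h.mono fun τ hτ => hdiv _ _ hτ))

theorem tangentS_modelDeriv {Φ : G → G} {f : M → M} (hΦ : 𝒢.IsHom 𝒢 Φ f) (a : G) (u : E) :
    𝒢.tangentS (Φ a) (modelDeriv I I Φ a u) = modelDeriv J J f (𝒢.s a) (𝒢.tangentS a u) := by
  obtain ⟨γ, hγ⟩ := HasVelocity.exists_curve (I := I) a u
  have h1 := velocity_s (𝒢 := 𝒢) (hγ.comp ((hΦ.smooth a).mdifferentiableAt (by simp)))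
  have h2 := (velocity_s (𝒢 := 𝒢) hγ).comp ((hΦ.smooth_base _).mdifferentiableAt (by simp))
  rw [hΦ.map_s] at h1
  exact h1.unique (h2.congr (Eventually.of_forall fun τ => hΦ.map_s _))

/-- The tangent map of the division map is smooth along smooth families of tangent vectors. -/
theorem contMDiffOn_divL {E₁ H₁ : Type*} [NormedAddCommGroup E₁] [NormedSpace ℝ E₁]
    [TopologicalSpace H₁] {K : ModelWithCorners ℝ E₁ H₁} {N : Type*} [TopologicalSpace N]
    [ChartedSpace H₁ N] {S : Set N} {a b : N → G} {u v : N → E}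
    (hu : ContMDiffOn K I.tangent ∞ (fun x => (⟨a x, u x⟩ : TangentBundle I G)) S)
    (hv : ContMDiffOn K I.tangent ∞ (fun x => (⟨b x, v x⟩ : TangentBundle I G)) S)
    (hab : ∀ x ∈ S, 𝒢.s (a x) = 𝒢.s (b x))
    (huv : ∀ x ∈ S, 𝒢.tangentS (a x) (u x) = 𝒢.tangentS (b x) (v x)) :
    ContMDiffOn K I.tangent ∞ (fun x => (⟨𝒢.mul (a x) (𝒢.inv (b x)),
      𝒢.divL (a x) (b x) (u x, v x)⟩ : TangentBundle I G)) S := by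
  intro x₀ hx₀
  obtain ⟨Θ, hΘ, h1, h2⟩ := 𝒢.submersion_s.exists_transport (b x₀)
  let q : G × G → M × G := fun p => (𝒢.s p.1, p.2)
  have hq : ContMDiff (I.prod I) (J.prod I) ∞ q :=
    (𝒢.contMDiff_s.comp contMDiff_fst).prodMk contMDiff_snd
  -- `F` extends division from `{s a = s b}` to a neighbourhood, by first moving the second arrow
  -- into the source fiber of the first. On an open set the ordinary tangent map is available and
  -- smooth.
  let F : G × G → G := fun p => 𝒢.mul p.1 (𝒢.inv (Θ (q p)))
  have hq0 : q (a x₀, b x₀) = (𝒢.s (b x₀), b x₀) := by simp [q, hab x₀ hx₀]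
  have hlim : Tendsto q (𝓝 (a x₀, b x₀)) (𝓝 (𝒢.s (b x₀), b x₀)) := by
    rw [← hq0]; exact hq.continuous.continuousAt
  obtain ⟨U, hU, hUo, hU0⟩ := eventually_nhds_iff.1
    ((hlim.eventually hΘ).and (hlim.eventually h1))
  have hF : ContMDiffOn (I.prod I) I ∞ F U := by
    refine 𝒢.contMDiffOn_div.comp (f := fun p : G × G => (p.1, Θ (q p))) ?_
      fun p hp => ((hU p hp).2).symm
    intro p hp
    exact (contMDiffAt_fst.prodMk ((hU p hp).1.comp p (hq p))).contMDiffWithinAt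
  have hTF := hF.contMDiffOn_tangentMapWithin (m := ∞) (by simp) hUo.uniqueMDiffOn
  let P : N → TangentBundle (I.prod I) (G × G) := fun x => ⟨(a x, b x), (u x, v x)⟩
  have hP : ContMDiffWithinAt K (I.prod I).tangent ∞ P S x₀ := by
    have := (contMDiff_equivTangentBundleProd_symm (I := I) (M := G) (I' := I) (M' := G)
      (n := ∞)).contMDiffAt.comp_contMDiffWithinAt x₀ ((hu x₀ hx₀).prodMk (hv x₀ hx₀))
    exact this
  have hPU : ∀ᶠ x in 𝓝[S] x₀, (a x, b x) ∈ U := by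
    have : ContinuousWithinAt (fun x => (P x).proj) S x₀ :=
      ((FiberBundle.continuous_proj (E × E)
        (TangentSpace (I.prod I) : G × G → Type _)).continuousAt).comp_continuousWithinAt
        hP.continuousWithinAt
    exact this (hUo.mem_nhds hU0)
  have hb2 : ∀ᶠ x in 𝓝[S] x₀, ∀ᶠ g in 𝓝 (b x), Θ (𝒢.s g, g) = g := by
    have : ContinuousWithinAt (fun x => (P x).proj.2) S x₀ :=
      continuous_snd.continuousAt.comp_continuousWithinAt
        (((FiberBundle.continuous_proj (E × E)
        (TangentSpace (I.prod I) : G × G → Type _)).continuousAt).comp_continuousWithinAt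
        hP.continuousWithinAt)
    exact this.eventually h2.eventually_nhds
  -- On compatible vectors the two tangent maps agree: along curves with equal sources the transport
  -- does nothing, so `F` and division trace the same curve.
  have hval : ∀ x ∈ S, (a x, b x) ∈ U → (∀ᶠ g in 𝓝 (b x), Θ (𝒢.s g, g) = g) →
      (⟨𝒢.mul (a x) (𝒢.inv (b x)), 𝒢.divL (a x) (b x) (u x, v x)⟩ : TangentBundle I G) =
        tangentMapWithin (I.prod I) I F U (P x) := by
    intro x hx hxU hxΘ
    obtain ⟨γ, η, hγ, hη, h⟩ := exists_curve_pair (hab x hx) (huv x hx)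
    have hFx : F (a x, b x) = 𝒢.mul (a x) (𝒢.inv (b x)) := by
      have := hxΘ.self_of_nhds
      simp only [F, q, hab x hx, this]
    have hv1 := (hγ.prodMk hη).comp_within
      ((hF _ hxU).mdifferentiableWithinAt (by simp))
      ((hγ.prodMk hη).eventually (hUo.mem_nhds hxU))
    have hv2 := (velocity_div hγ hη h).congr (γ' := fun τ => F (γ τ, η τ)) (by
      filter_upwards [h, hη.eventually hxΘ] with τ h1 h2
      simp only [F, q, h1, h2])
    rw [hFx] at hv1
    have hEq := hv2.unique hv1
    change _ = (⟨F (a x, b x), _⟩ : TangentBundle I G)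
    rw [hEq]
    exact Bundle.TotalSpace.ext hFx.symm HEq.rfl
  have hcomp := ContMDiffWithinAt.comp x₀ (t := π (E × E) (TangentSpace (I.prod I)) ⁻¹' U)
    (hTF (P x₀) hU0) (hP.mono (inter_subset_left (t := (fun x => (a x, b x)) ⁻¹' U)))
    (fun x hx => hx.2)
  have hcomp' : ContMDiffWithinAt K I.tangent ∞ (tangentMapWithin (I.prod I) I F U ∘ P) S x₀ :=
    hcomp.mono_of_mem_nhdsWithin (inter_mem self_mem_nhdsWithin hPU)
  refine hcomp'.congr_of_eventuallyEq ?_ (hval x₀ hx₀ hU0 h2)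
  filter_upwards [self_mem_nhdsWithin, hPU, hb2] with x h1 h2 h3 using hval x h1 h2 h3

end Tangent

end LieGroupoid

/-- The usual cancellation of double faces. In the induction the new row `j = m + 1` equals the new
column `i = m` by `hA`, with the opposite sign. -/
theorem sum_alternating_eq_zero {E : Type*} [AddCommGroup E] [Module ℝ E] {A : ℕ → ℕ → E}
    (hA : ∀ i j, i ≤ j → A i (j + 1) = A j i) (m : ℕ) :
    ∑ j ∈ Finset.range (m + 1), (-1 : ℝ) ^ j • ∑ i ∈ Finset.range m, (-1 : ℝ) ^ i • A i j = 0 := by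
  induction m with
  | zero => simp
  | succ m ih =>
    have h : ∑ j ∈ Finset.range (m + 1),
        (-1 : ℝ) ^ j • ∑ i ∈ Finset.range (m + 1), (-1 : ℝ) ^ i • A i j =
          ∑ j ∈ Finset.range (m + 1), (-1 : ℝ) ^ j • (-1 : ℝ) ^ m • A m j := by
      simp_rw [Finset.sum_range_succ (fun i => (-1 : ℝ) ^ i • A i _) m, smul_add,
        Finset.sum_add_distrib]
      rw [ih, zero_add]
    rw [Finset.sum_range_succ, h, Finset.smul_sum, ← Finset.sum_add_distrib]
    refine Finset.sum_eq_zero fun j hj => ?_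
    rw [hA j m (by simpa [Nat.lt_succ_iff] using hj), smul_smul, smul_smul, ← add_smul]
    rw [show (-1 : ℝ) ^ j * (-1) ^ m + (-1) ^ (m + 1) * (-1) ^ j = 0 by ring, zero_smul]

section Tangent

variable {E H : Type*} [NormedAddCommGroup E] [NormedSpace ℝ E] [TopologicalSpace H]
  {I : ModelWithCorners ℝ E H} {G : Type*} [TopologicalSpace G] [ChartedSpace H G]

theorem tangentBundle_mk_congr {x y : G} {v w : E} (hxy : x = y) (hvw : v = w) :
    (⟨x, v⟩ : TangentBundle I G) = ⟨y, w⟩ := by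
  subst hxy hvw; rfl

variable {E' H' : Type*} [NormedAddCommGroup E'] [NormedSpace ℝ E'] [TopologicalSpace H']
  {J : ModelWithCorners ℝ E' H'} {N : Type*} [TopologicalSpace N] [ChartedSpace H' N]
  [IsManifold I ∞ G]

theorem contMDiffOn_sum_along {b : N → G} {v : ℕ → N → E} {S : Set N} (m : ℕ)
    (hb : ContMDiffOn J I ∞ b S)
    (hv : ∀ j, ContMDiffOn J I.tangent ∞ (fun x => (⟨b x, v j x⟩ : TangentBundle I G)) S) :
    ContMDiffOn J I.tangent ∞
      (fun x => (⟨b x, ∑ j ∈ Finset.range m, (-1 : ℝ) ^ j • v j x⟩ : TangentBundle I G)) S := by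
  induction m with
  | zero => exact contMDiffOn_zero_along hb
  | succ m ih =>
    refine (contMDiffOn_add_along ih (contMDiffOn_smul_along ((-1) ^ m) (hv m))).congr
      fun x _ => tangentBundle_mk_congr rfl ?_
    exact Finset.sum_range_succ (M := E) _ m

end Tangent

/-! ### The deformation complex of a Lie groupoid. -/

namespace LieGroupoid

section Differential

variable {E H E' H' : Type*} [NormedAddCommGroup E] [NormedSpace ℝ E]
  [TopologicalSpace H] [NormedAddCommGroup E'] [NormedSpace ℝ E'] [TopologicalSpace H']
  {I : ModelWithCorners ℝ E H} {J : ModelWithCorners ℝ E' H'}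
  {G M : Type u} [TopologicalSpace G] [ChartedSpace H G] [IsManifold I ∞ G]
  [TopologicalSpace M] [ChartedSpace H' M] [IsManifold J ∞ M]
  {𝒢 : LieGroupoid I J G M}

/-- The value of a cochain at a point as a vector of the model space. -/
def vec {n : ℕ} (c : 𝒢.Cochain n) (p : 𝒢.Pt n) : E := c p

/-- The value of a cochain of degree `-1` at a point of `M`. -/
def vecUnit (α : 𝒢.Cochain 0) (x : M) : E := 𝒢.vec α x

/-- The value of a cochain of degree `n` at a tuple of composable arrows. -/
def vecTuple {n : ℕ} (c : 𝒢.Cochain (n + 1)) (g : 𝒢.composable n) : E := 𝒢.vec c g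

theorem cochain_ext_tuple {n : ℕ} {c d : 𝒢.Cochain (n + 1)}
    (h : ∀ g, 𝒢.vecTuple c g = 𝒢.vecTuple d g) : c = d :=
  funext h

/-- The condition on the source components in the definition of deformation cochains. -/
def IsSourceCompatible : ∀ {n : ℕ}, 𝒢.Cochain n → Prop
  | 0, α => ∀ x, 𝒢.tangentS (𝒢.one x) (𝒢.vecUnit α x) = 0
  | n + 1, c => ∀ g g' : 𝒢.composable n, (∀ i : Fin n, g.1 i.succ = g'.1 i.succ) →
      𝒢.s (g.1 0) = 𝒢.s (g'.1 0) →
        𝒢.tangentS (g.1 0) (𝒢.vecTuple c g) = 𝒢.tangentS (g'.1 0) (𝒢.vecTuple c g')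

/-- The smoothness condition in the definition of deformation cochains. -/
def IsSmoothCochain : ∀ {n : ℕ}, 𝒢.Cochain n → Prop
  | 0, α => ContMDiff J I.tangent ∞ (fun x : M => (⟨𝒢.one x, 𝒢.vecUnit α x⟩ : TangentBundle I G))
  | n + 1, c => ContMDiffOn (ModelWithCorners.pi fun _ : Fin (n + 1) => I) I.tangent ∞
      (fun g : Fin (n + 1) → G => (⟨g 0, 𝒢.extendZero c g⟩ : TangentBundle I G))
      (𝒢.composable n)

theorem mem_defCochains {n : ℕ} {c : 𝒢.Cochain n} :
    c ∈ 𝒢.defCochains n ↔ 𝒢.IsSourceCompatible c ∧ 𝒢.IsSmoothCochain c := by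
  cases n with
  | zero => exact Iff.rfl
  | succ n => exact and_comm

/-! ### Faces -/

/-- `(g₀, …, gₙ₊₁) ↦ (g₀, …, gⱼ gⱼ₊₁, …, gₙ₊₁)`, which omits the last arrow if `j > n`. -/
def faceFun (𝒢 : LieGroupoid I J G M) {n : ℕ} (j : ℕ) (g : Fin (n + 2) → G) : Fin (n + 1) → G :=
  fun k => if (k : ℕ) < j then g k.castSucc
    else if (k : ℕ) = j then 𝒢.mul (g k.castSucc) (g k.succ) else g k.succ

theorem faceFun_mem {n : ℕ} (j : ℕ) {g : Fin (n + 2) → G} (hg : g ∈ 𝒢.composable (n + 1)) :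
    𝒢.faceFun j g ∈ 𝒢.composable n := by
  intro i
  have h0 : 𝒢.s (g i.castSucc.castSucc) = 𝒢.t (g i.castSucc.succ) := hg i.castSucc
  have h1 : 𝒢.s (g i.castSucc.succ) = 𝒢.t (g i.succ.succ) := hg i.succ
  have hc : i.succ.castSucc = i.castSucc.succ := rfl
  simp only [faceFun, Fin.val_castSucc, Fin.val_succ, hc]
  split_ifs <;> first | omega | simp only [𝒢.s_mul _ _ h0, 𝒢.t_mul _ _ h1, h0, h1]

/-- `faceFun` on composable tuples. -/
def face {n : ℕ} (j : ℕ) (g : 𝒢.composable (n + 1)) : 𝒢.composable n :=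
  ⟨𝒢.faceFun j g.1, faceFun_mem j g.2⟩

theorem dropLast_eq_face {n : ℕ} (g : 𝒢.composable (n + 1)) : 𝒢.dropLast g = face (n + 1) g := by
  refine Subtype.ext (funext fun k => ?_)
  simp [face, faceFun, dropLast, k.2]

theorem face_zero_succ {n : ℕ} (g : 𝒢.composable (n + 1)) (i : Fin n) :
    (face 0 g).1 i.succ = g.1 i.succ.succ := by
  simp [face, faceFun]

theorem face_succ_zero {n : ℕ} (j : ℕ) (g : 𝒢.composable (n + 1)) :
    (face (j + 1) g).1 0 = g.1 0 := by
  simp [face, faceFun]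

/-- Associativity enters only for `i = j`; for `i < j` the two multiplications involve disjoint
pairs of arrows. -/
theorem face_face {n : ℕ} {i j : ℕ} (hij : i ≤ j) (g : 𝒢.composable (n + 2)) :
    face i (face (j + 1) g) = face j (face i g) := by
  refine Subtype.ext (funext fun k => ?_)
  have h0 : 𝒢.s (g.1 k.castSucc.castSucc) = 𝒢.t (g.1 k.castSucc.succ) := g.2 k.castSucc
  have h1 : 𝒢.s (g.1 k.castSucc.succ) = 𝒢.t (g.1 k.succ.succ) := g.2 k.succ
  have hc : k.succ.castSucc = k.castSucc.succ := rfl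
  simp only [face, faceFun, Fin.val_castSucc, Fin.val_succ, hc]
  split_ifs <;> first | omega | rfl | exact (𝒢.mul_assoc _ _ _ h0 h1).symm

theorem dropFirst_face_succ {n : ℕ} (j : ℕ) (g : 𝒢.composable (n + 2)) :
    𝒢.dropFirst (face (j + 1) g) = face j (𝒢.dropFirst g) := by
  refine Subtype.ext (funext fun k => ?_)
  have hc : k.succ.castSucc = k.castSucc.succ := rfl
  simp only [face, faceFun, dropFirst, Fin.val_succ, hc]
  split_ifs <;> first | omega | rfl

theorem dropFirst_face_zero {n : ℕ} (g : 𝒢.composable (n + 2)) :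
    𝒢.dropFirst (face 0 g) = 𝒢.dropFirst (𝒢.dropFirst g) :=
  Subtype.ext (funext fun k => face_zero_succ g k)

theorem dropFirst_zero {n : ℕ} (g : 𝒢.composable (n + 1)) : (𝒢.dropFirst g).1 0 = g.1 1 := rfl

theorem s_face_zero {n : ℕ} (g : 𝒢.composable (n + 1)) :
    𝒢.s ((face 0 g).1 0) = 𝒢.s (g.1 1) :=
  𝒢.s_mul _ _ (g.2 0)

theorem div_face_zero {n : ℕ} (g : 𝒢.composable (n + 1)) :
    𝒢.mul ((face 0 g).1 0) (𝒢.inv (g.1 1)) = g.1 0 :=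
  𝒢.mul_mul_inv_cancel (g.2 0)

/-! ### Formulas for the differential -/

/-- The first term of the differential, up to sign. -/
noncomputable def divTerm {n : ℕ} (c : 𝒢.Cochain (n + 1)) (g : 𝒢.composable (n + 1)) : E :=
  𝒢.divL ((face 0 g).1 0) (g.1 1) (vecTuple c (face 0 g), vecTuple c (𝒢.dropFirst g))

/-- Omitting the last arrow is the face with index `n + 1`, so the contractions and the last term
merge into one alternating sum, to which the simplicial cancellation applies. -/
theorem vecTuple_diff {n : ℕ} (c : 𝒢.Cochain (n + 1)) (g : 𝒢.composable (n + 1)) :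
    vecTuple (𝒢.diff (n + 1) c) g = -divTerm c g +
      ∑ j ∈ Finset.range (n + 1), (-1 : ℝ) ^ j • vecTuple c (face (j + 1) g) := by
  let L : Fin n → 𝒢.Cochain (n + 1) →ₗ[ℝ] E := fun i => (-1 : ℝ) ^ (i : ℕ) •
    (tangentCast I (𝒢.contract_succ_zero i g) ∘ₗ 𝒢.evalTuple (𝒢.contract i.succ g))
  have h : vecTuple (𝒢.diff (n + 1) c) g = -divTerm c g + (∑ i : Fin n, L i) c +
      (-1 : ℝ) ^ n • vecTuple c (𝒢.dropLast g) := rfl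
  rw [h, Finset.sum_range_succ, dropLast_eq_face, ← add_assoc, LinearMap.sum_apply,
    Finset.sum_range]
  rfl

/-- The two tuples differ only in their first arrow, `g₀g₁` against `g₁`. The source condition on
cochains is thus exactly what makes the division term meaningful. -/
theorem tangentS_face_eq {n : ℕ} {c : 𝒢.Cochain (n + 1)} (hc : IsSourceCompatible c)
    (g : 𝒢.composable (n + 1)) :
    𝒢.tangentS ((face 0 g).1 0) (vecTuple c (face 0 g)) =
      𝒢.tangentS (g.1 1) (vecTuple c (𝒢.dropFirst g)) :=
  hc (face 0 g) (𝒢.dropFirst g) (fun i => face_zero_succ g i) (s_face_zero g)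

end Differential

end LieGroupoid

namespace LieGroupoid

section Differential

variable {E H E' H' : Type*} [NormedAddCommGroup E] [NormedSpace ℝ E]
  [TopologicalSpace H] [NormedAddCommGroup E'] [NormedSpace ℝ E'] [TopologicalSpace H']
  {I : ModelWithCorners ℝ E H} {J : ModelWithCorners ℝ E' H'}
  {G M : Type u} [TopologicalSpace G] [ChartedSpace H G] [IsManifold I ∞ G]
  [TopologicalSpace M] [ChartedSpace H' M] [IsManifold J ∞ M]
  {𝒢 : LieGroupoid I J G M}

theorem left_compat {α : 𝒢.Cochain 0} (hα : IsSourceCompatible α) (g : G) :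
    𝒢.tangentS g 0 = 𝒢.tangentS (𝒢.one (𝒢.s g)) (vecUnit α (𝒢.s g)) := by
  rw [hα, map_zero]

theorem right_compat {α : 𝒢.Cochain 0} (hα : IsSourceCompatible α) (g : G) :
    𝒢.tangentS (𝒢.one (𝒢.t g)) (vecUnit α (𝒢.t g)) = 𝒢.tangentS (𝒢.inv g) 0 := by
  rw [hα, map_zero]

theorem divTerm_face_succ {n : ℕ} (c : 𝒢.Cochain (n + 1)) (j : ℕ) (p : 𝒢.composable (n + 2)) :
    divTerm c (face (j + 2) p) = 𝒢.divL ((face 0 p).1 0) (p.1 1)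
      (vecTuple c (face (j + 1) (face 0 p)), vecTuple c (face (j + 1) (𝒢.dropFirst p))) := by
  have h1 : (face (j + 2) p).1 1 = p.1 1 := by
    rw [← dropFirst_zero, dropFirst_face_succ, face_succ_zero, dropFirst_zero]
  rw [divTerm, h1, face_face (Nat.zero_le _), dropFirst_face_succ, face_succ_zero]

theorem extendZero_eq {n : ℕ} (c : 𝒢.Cochain (n + 1)) {g : Fin (n + 1) → G}
    (hg : g ∈ 𝒢.composable n) : (𝒢.extendZero c g : E) = vecTuple c ⟨g, hg⟩ :=
  𝒢.extendZero_of_mem hg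

theorem contMDiffOn_faceFun (𝒢 : LieGroupoid I J G M) {n : ℕ} (j : ℕ) :
    ContMDiffOn (ModelWithCorners.pi fun _ : Fin (n + 2) => I)
      (ModelWithCorners.pi fun _ : Fin (n + 1) => I) ∞ (𝒢.faceFun (n := n) j)
      (𝒢.composable (n + 1)) := by
  intro g hg
  refine ContMDiffWithinAt.pi_manifold fun k => ?_
  unfold faceFun
  by_cases h1 : (k : ℕ) < j
  · simp only [h1, if_true]
    exact (contMDiff_pi_eval _).contMDiffAt.contMDiffWithinAt
  by_cases h2 : (k : ℕ) = j
  · simp only [h2, if_true, if_false, lt_irrefl]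
    exact (𝒢.smooth_mul (g k.castSucc, g k.succ) (hg k)).comp g
      (((contMDiff_pi_eval _).prodMk (contMDiff_pi_eval _)).contMDiffAt.contMDiffWithinAt)
      fun g (hg : g ∈ 𝒢.composable (n + 1)) => hg k
  · simp only [h1, h2, if_false]
    exact (contMDiff_pi_eval _).contMDiffAt.contMDiffWithinAt

variable [I.Boundaryless]

/-! ### Invariant vector fields -/

/-- A vector in the Lie algebroid is the velocity of a curve in a source fiber. -/
theorem exists_curve_unit {x : M} {u : E} (hu : 𝒢.tangentS (𝒢.one x) u = 0) :
    ∃ γ : ℝ → G, HasVelocity I γ (𝒢.one x) u ∧ ∀ᶠ τ in 𝓝 0, 𝒢.s (γ τ) = x := by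
  have h := HasVelocity.const (I := J) (𝒢.s (𝒢.one x))
  obtain ⟨γ, hγ, hs⟩ := HasVelocity.exists_lift 𝒢.submersion_s (b := 𝒢.one x) (v := u)
    (η := fun _ => 𝒢.s (𝒢.one x)) (by
      have h' : HasVelocity J (fun _ : ℝ => 𝒢.s (𝒢.one x)) (𝒢.s (𝒢.one x))
        (𝒢.tangentS (𝒢.one x) u) := by rw [hu]; exact h
      exact h')
  exact ⟨γ, hγ, hs.mono fun τ hτ => hτ.trans (𝒢.s_one x)⟩

/-- For a curve `γ` in the source fiber representing `α`, the field is the velocity of `g γ(τ)⁻¹`.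
With its right-invariant analogue, `γ(τ) (g⁻¹)⁻¹`, it brings degree `-1` under the division lemmas.
-/
theorem leftInvariant_eq {α : 𝒢.Cochain 0} (hα : IsSourceCompatible α) (g : G) :
    (𝒢.leftInvariant g α : E) = 𝒢.divL g (𝒢.one (𝒢.s g)) (0, vecUnit α (𝒢.s g)) := by
  obtain ⟨γ, hγ, hs⟩ := exists_curve_unit (hα (𝒢.s g))
  have hg : 𝒢.mul g (𝒢.inv (𝒢.one (𝒢.s g))) = g := by rw [𝒢.inv_one, 𝒢.mul_one]
  have h1 := velocity_div (𝒢 := 𝒢) (HasVelocity.const (I := I) g) hγ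
    (hs.mono fun τ hτ => hτ.symm)
  have h2 := hγ.comp ((𝒢.smooth_inv (𝒢.one (𝒢.s g))).mdifferentiableAt (by simp))
  rw [𝒢.inv_one] at h2
  have hL : ContMDiffOn I I ∞ (fun h => 𝒢.mul g h) {h | 𝒢.t h = 𝒢.s g} :=
    𝒢.smooth_mul.comp (f := fun h : G => (g, h)) (contMDiff_const.prodMk contMDiff_id).contMDiffOn
      fun h hh => Eq.symm hh
  have h3 := h2.comp_within ((hL (𝒢.one (𝒢.s g)) (𝒢.t_one _)).mdifferentiableWithinAt (by simp))
    (hs.mono fun τ hτ => (𝒢.t_inv _).trans hτ)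
  rw [𝒢.mul_one] at h3
  rw [hg] at h1
  exact h3.unique h1

theorem rightInvariant_eq {α : 𝒢.Cochain 0} (hα : IsSourceCompatible α) (g : G) :
    (𝒢.rightInvariant g α : E) = 𝒢.divL (𝒢.one (𝒢.t g)) (𝒢.inv g) (vecUnit α (𝒢.t g), 0) := by
  obtain ⟨γ, hγ, hs⟩ := exists_curve_unit (hα (𝒢.t g))
  have hg : 𝒢.mul (𝒢.one (𝒢.t g)) (𝒢.inv (𝒢.inv g)) = g := by rw [𝒢.inv_inv, 𝒢.one_mul]
  have h1 := velocity_div (𝒢 := 𝒢) hγ (HasVelocity.const (I := I) (𝒢.inv g))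
    (hs.mono fun τ hτ => hτ.trans (𝒢.s_inv g).symm)
  have hR : ContMDiffOn I I ∞ (fun h => 𝒢.mul h g) {h | 𝒢.s h = 𝒢.t g} :=
    𝒢.smooth_mul.comp (f := fun h : G => (h, g)) (contMDiff_id.prodMk contMDiff_const).contMDiffOn
      fun h hh => hh
  have h3 := hγ.comp_within
    ((hR (𝒢.one (𝒢.t g)) (𝒢.s_one _)).mdifferentiableWithinAt (by simp)) hs
  rw [𝒢.one_mul] at h3
  rw [hg] at h1
  simp_rw [𝒢.inv_inv] at h1
  exact h3.unique h1

/-- The value of the differential of a cochain of degree `-1`. -/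
noncomputable def diffUnit (α : 𝒢.Cochain 0) (g : G) : E :=
  𝒢.divL g (𝒢.one (𝒢.s g)) (0, vecUnit α (𝒢.s g)) +
    𝒢.divL (𝒢.one (𝒢.t g)) (𝒢.inv g) (vecUnit α (𝒢.t g), 0)

theorem vecTuple_diff_zero {α : 𝒢.Cochain 0} (hα : IsSourceCompatible α) (g : 𝒢.composable 0) :
    vecTuple (𝒢.diff 0 α) g = diffUnit α (g.1 0) := by
  have h : vecTuple (𝒢.diff 0 α) g =
    (𝒢.leftInvariant (g.1 0) α : E) + (𝒢.rightInvariant (g.1 0) α : E) := rfl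
  rw [h, leftInvariant_eq hα, rightInvariant_eq hα]
  rfl

theorem tangentS_diffUnit {α : 𝒢.Cochain 0} (hα : IsSourceCompatible α) (g : G) :
    𝒢.tangentS g (diffUnit α g) = 𝒢.tangentT (𝒢.one (𝒢.s g)) (vecUnit α (𝒢.s g)) := by
  have h1 := tangentS_divL (𝒢 := 𝒢) (𝒢.s_one (𝒢.s g)).symm (left_compat hα g)
  have h2 := tangentS_divL (𝒢 := 𝒢) ((𝒢.s_one (𝒢.t g)).trans (𝒢.s_inv g).symm) (right_compat hα g)
  rw [𝒢.inv_one, 𝒢.mul_one] at h1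
  rw [𝒢.inv_inv, 𝒢.one_mul, map_zero] at h2
  rw [diffUnit, map_add, h1, h2, add_zero]

/-- Multiplicativity of `δα`, which is `δ² = 0` in the lowest degree. The left-invariant parts at
`gh` and `h` cancel. The right-invariant part at `gh` gives the one at `g`, since `γ g h h⁻¹ = γ g`.
The right-invariant part at `h` becomes the left-invariant one at `g`, since `g h (γ h)⁻¹ = g γ⁻¹`.
-/
theorem divL_diffUnit {α : 𝒢.Cochain 0} (hα : IsSourceCompatible α) {g h : G}
    (hgh : 𝒢.s g = 𝒢.t h) :
    𝒢.divL (𝒢.mul g h) h (diffUnit α (𝒢.mul g h), diffUnit α h) = diffUnit α g := by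
  have hs : 𝒢.s (𝒢.mul g h) = 𝒢.s h := 𝒢.s_mul _ _ hgh
  have ht : 𝒢.t (𝒢.mul g h) = 𝒢.t g := 𝒢.t_mul _ _ hgh
  have hsplit : (diffUnit α (𝒢.mul g h), diffUnit α h) =
      (𝒢.divL (𝒢.mul g h) (𝒢.one (𝒢.s h)) (0, vecUnit α (𝒢.s h)),
        𝒢.divL h (𝒢.one (𝒢.s h)) (0, vecUnit α (𝒢.s h))) +
      ((𝒢.divL (𝒢.one (𝒢.t g)) (𝒢.inv (𝒢.mul g h)) (vecUnit α (𝒢.t g), 0), 0) +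
        (0, 𝒢.divL (𝒢.one (𝒢.t h)) (𝒢.inv h) (vecUnit α (𝒢.t h), 0))) := by
    simp only [diffUnit, hs, ht, Prod.mk_add_mk, add_zero, zero_add]
  have h1 : 𝒢.divL (𝒢.mul g h) h (𝒢.divL (𝒢.mul g h) (𝒢.one (𝒢.s h)) (0, vecUnit α (𝒢.s h)),
      𝒢.divL h (𝒢.one (𝒢.s h)) (0, vecUnit α (𝒢.s h))) = 0 := by
    have := divL_divL (𝒢 := 𝒢) (a := 𝒢.mul g h) (b := h) (c := 𝒢.one (𝒢.s h)) (u := 0) (v := 0)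
      (w := vecUnit α (𝒢.s h)) (by rw [hs, 𝒢.s_one]) (by rw [𝒢.s_one])
      (by rw [hα, map_zero]) (left_compat hα h)
    rw [𝒢.inv_one, 𝒢.mul_one, ← hs, 𝒢.mul_one, hs] at this
    rw [this]
    exact map_zero _
  have h2 : 𝒢.divL (𝒢.mul g h) h
      (𝒢.divL (𝒢.one (𝒢.t g)) (𝒢.inv (𝒢.mul g h)) (vecUnit α (𝒢.t g), 0), 0) =
        𝒢.divL (𝒢.one (𝒢.t g)) (𝒢.inv g) (vecUnit α (𝒢.t g), 0) := by
    obtain ⟨γ, hγ, hγs⟩ := exists_curve_unit (hα (𝒢.t g))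
    have e1 := velocity_div (𝒢 := 𝒢) hγ (HasVelocity.const (I := I) (𝒢.inv (𝒢.mul g h)))
      (hγs.mono fun τ hτ => by rw [hτ, 𝒢.s_inv, ht])
    have hpt : 𝒢.mul (𝒢.one (𝒢.t g)) (𝒢.inv (𝒢.inv (𝒢.mul g h))) = 𝒢.mul g h := by
      rw [𝒢.inv_inv, ← ht, 𝒢.one_mul]
    rw [hpt] at e1
    have e2 := velocity_div (𝒢 := 𝒢) e1 (HasVelocity.const (I := I) h) (by
      filter_upwards [hγs] with τ hτ
      rw [𝒢.inv_inv, 𝒢.s_mul _ _ (by rw [hτ, ht]), hs])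
    have e3 := velocity_div (𝒢 := 𝒢) hγ (HasVelocity.const (I := I) (𝒢.inv g))
      (hγs.mono fun τ hτ => by rw [hτ, 𝒢.s_inv])
    rw [𝒢.mul_mul_inv_cancel hgh] at e2
    rw [𝒢.inv_inv, 𝒢.one_mul] at e3
    refine e2.unique (e3.congr ?_)
    filter_upwards [hγs] with τ hτ
    rw [𝒢.inv_inv, ← 𝒢.mul_assoc _ _ _ hτ hgh,
      𝒢.mul_mul_inv_cancel (by rw [𝒢.s_mul _ _ hτ, hgh])]
  have h3 : 𝒢.divL (𝒢.mul g h) h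
      (0, 𝒢.divL (𝒢.one (𝒢.t h)) (𝒢.inv h) (vecUnit α (𝒢.t h), 0)) =
        𝒢.divL g (𝒢.one (𝒢.s g)) (0, vecUnit α (𝒢.s g)) := by
    rw [hgh]
    obtain ⟨γ, hγ, hγs⟩ := exists_curve_unit (hα (𝒢.t h))
    have e1 := velocity_div (𝒢 := 𝒢) hγ (HasVelocity.const (I := I) (𝒢.inv h))
      (hγs.mono fun τ hτ => by rw [hτ, 𝒢.s_inv])
    rw [𝒢.inv_inv, 𝒢.one_mul] at e1
    have e2 := velocity_div (𝒢 := 𝒢) (HasVelocity.const (I := I) (𝒢.mul g h)) e1 (by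
      filter_upwards [hγs] with τ hτ
      rw [𝒢.s_mul _ _ hτ, hs])
    have e3 := velocity_div (𝒢 := 𝒢) (HasVelocity.const (I := I) g) hγ
      (hγs.mono fun τ hτ => by rw [hτ, hgh])
    rw [𝒢.mul_mul_inv_cancel hgh] at e2
    rw [𝒢.inv_one, ← hgh, 𝒢.mul_one, hgh] at e3
    refine e2.unique (e3.congr ?_)
    filter_upwards [hγs] with τ hτ
    rw [𝒢.inv_mul_rev hτ, ← 𝒢.mul_assoc _ _ _ (by rw [hs, 𝒢.t_inv])
      (by rw [𝒢.s_inv, 𝒢.t_inv, hτ]), 𝒢.mul_mul_inv_cancel hgh]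
  rw [hsplit, map_add, map_add, h1, h2, h3, zero_add, add_comm]
  rfl

/-! ### The differential squares to zero -/

/-- This is `divL_divL` at `a = p₀p₁p₂`, `b = p₁p₂`, `c = p₂`. -/
theorem divL_divTerm {n : ℕ} {c : 𝒢.Cochain (n + 1)} (hc : IsSourceCompatible c)
    (p : 𝒢.composable (n + 2)) :
    𝒢.divL ((face 0 p).1 0) (p.1 1) (divTerm c (face 0 p), divTerm c (𝒢.dropFirst p)) =
      divTerm c (face 1 p) := by
  have hw : (face 0 p).1 1 = p.1 2 := face_zero_succ p 0
  have hw' : (𝒢.dropFirst p).1 1 = p.1 2 := rfl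
  have h1 := tangentS_face_eq hc (face 0 p)
  have h2 := tangentS_face_eq hc (𝒢.dropFirst p)
  have s1 := s_face_zero (face 0 p)
  have s2 := s_face_zero (𝒢.dropFirst p)
  rw [hw] at h1 s1
  rw [hw'] at h2 s2
  rw [dropFirst_face_zero] at h1
  have h := divL_divL s1 s2 h1 h2
  have e1 := div_face_zero (face 0 p)
  have e2 := div_face_zero (𝒢.dropFirst p)
  rw [hw] at e1
  rw [hw', dropFirst_zero] at e2
  rw [e1, e2] at h
  have h3 : (face 1 p).1 1 = (face 0 (𝒢.dropFirst p)).1 0 := by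
    rw [← dropFirst_zero, dropFirst_face_succ]
  rw [divTerm, divTerm, divTerm, hw, hw', dropFirst_face_zero, h, h3, face_face (Nat.zero_le _),
    dropFirst_face_succ]

theorem diff_diff {n : ℕ} {c : 𝒢.Cochain n} (hc : IsSourceCompatible c) :
    𝒢.diff (n + 1) (𝒢.diff n c) = 0 := by
  refine cochain_ext_tuple fun p => ?_
  cases n with
  | zero =>
    have h := vecTuple_diff (𝒢.diff 0 c) p
    have hp : 𝒢.s (p.1 0) = 𝒢.t (p.1 1) := p.2 0
    have h2 : divTerm (𝒢.diff 0 c) p = diffUnit c (p.1 0) := by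
      rw [divTerm, vecTuple_diff_zero hc, vecTuple_diff_zero hc]
      exact divL_diffUnit hc hp
    rw [h2, Finset.sum_range_one, vecTuple_diff_zero hc, face_succ_zero, pow_zero, one_smul,
      neg_add_cancel] at h
    exact h
  | succ n =>
    have h := vecTuple_diff (𝒢.diff (n + 1) c) p
    have hdiv : divTerm (𝒢.diff (n + 1) c) p = -divTerm c (face 1 p) +
        ∑ j ∈ Finset.range (n + 1), (-1 : ℝ) ^ j • divTerm c (face (j + 2) p) := by
      have hpair : (vecTuple (𝒢.diff (n + 1) c) (face 0 p),
          vecTuple (𝒢.diff (n + 1) c) (𝒢.dropFirst p)) =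
          -(divTerm c (face 0 p), divTerm c (𝒢.dropFirst p)) +
          ∑ j ∈ Finset.range (n + 1), (-1 : ℝ) ^ j •
            (vecTuple c (face (j + 1) (face 0 p)),
              vecTuple c (face (j + 1) (𝒢.dropFirst p))) := by
        rw [vecTuple_diff, vecTuple_diff]
        ext <;> simp [Prod.fst_sum, Prod.snd_sum]
      rw [divTerm.eq_def (𝒢.diff (n + 1) c), hpair, map_add, map_neg, map_sum, divL_divTerm hc]
      congr 1
      refine Finset.sum_congr rfl fun j _ => ?_
      rw [map_smul, divTerm_face_succ]
    -- The double faces cancel among themselves, so only division terms remain.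
    have hsum : ∑ j ∈ Finset.range (n + 2), (-1 : ℝ) ^ j •
        vecTuple (𝒢.diff (n + 1) c) (face (j + 1) p) =
          -∑ j ∈ Finset.range (n + 2), (-1 : ℝ) ^ j • divTerm c (face (j + 1) p) := by
      have h0 := sum_alternating_eq_zero
        (A := fun i j => vecTuple c (face (i + 1) (face (j + 1) p)))
        (fun i j hij => by rw [face_face (by omega : i + 1 ≤ j + 1)]) (n + 1)
      rw [← add_zero (-∑ j ∈ _, _), ← h0, ← Finset.sum_neg_distrib, ← Finset.sum_add_distrib]
      refine Finset.sum_congr rfl fun j _ => ?_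
      rw [vecTuple_diff, smul_add, smul_neg]
    -- Splitting off `j = 0` isolates the term at `face 1`, which cancels the one from
    -- `divL_divTerm`; the remaining terms at `face (j + 2)` cancel after the shift of sign.
    rw [hdiv, hsum, Finset.sum_range_succ' _ (n + 1)] at h
    refine h.trans ?_
    simp only [pow_succ, mul_neg_one, neg_smul, Finset.sum_neg_distrib, pow_zero, one_smul,
      zero_add, add_assoc, Nat.reduceAdd]
    change _ = (0 : E)
    abel

/-! ### The differential preserves the source condition -/

theorem IsSourceCompatible.diff {n : ℕ} {c : 𝒢.Cochain n} (hc : IsSourceCompatible c) :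
    IsSourceCompatible (𝒢.diff n c) := by
  cases n with
  | zero =>
    intro g g' _ h
    rw [vecTuple_diff_zero hc, vecTuple_diff_zero hc, tangentS_diffUnit hc, tangentS_diffUnit hc, h]
  | succ n =>
    intro g g' hg hs
    have hd : 𝒢.dropFirst g = 𝒢.dropFirst g' := Subtype.ext (funext hg)
    -- The source component of the division term is `Tt` of the value at `(p₁, …)`, in which `p₀` no
    -- longer occurs.
    have h1 : ∀ p : 𝒢.composable (n + 1), 𝒢.tangentS (p.1 0) (divTerm c p) =
        𝒢.tangentT (p.1 1) (vecTuple c (𝒢.dropFirst p)) := by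
      intro p
      have := tangentS_divL (s_face_zero p) (tangentS_face_eq hc p)
      rwa [div_face_zero] at this
    have h2 : ∀ j, 𝒢.tangentS (g.1 0) (vecTuple c (face (j + 1) g)) =
        𝒢.tangentS (g'.1 0) (vecTuple c (face (j + 1) g')) := by
      intro j
      have := hc (face (j + 1) g) (face (j + 1) g') (fun i => ?_)
        (by rw [face_succ_zero, face_succ_zero, hs])
      · rwa [face_succ_zero, face_succ_zero] at this
      · have e : ∀ k : Fin (n + 1), g.1 k.succ = g'.1 k.succ := hg
        have hcs : i.succ.castSucc = i.castSucc.succ := rfl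
        simp only [face, faceFun, e, hcs]
    rw [vecTuple_diff, vecTuple_diff, map_add, map_add, map_neg, map_neg, h1, h1, hd,
      show g.1 1 = g'.1 1 from hg 0, map_sum, map_sum]
    congr 1
    refine Finset.sum_congr rfl fun j _ => ?_
    rw [map_smul, map_smul, h2]

/-! ### The differential preserves smoothness -/

theorem IsSmoothCochain.diff {n : ℕ} {c : 𝒢.Cochain n} (hc : IsSourceCompatible c)
    (hsm : IsSmoothCochain c) : IsSmoothCochain (𝒢.diff n c) := by
  cases n with
  | zero =>
    have h0 : ContMDiff (ModelWithCorners.pi fun _ : Fin 1 => I) I ∞ (fun g : Fin 1 → G => g 0) :=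
      contMDiff_pi_eval 0
    have hα : ContMDiff J I.tangent ∞
      (fun x : M => (⟨𝒢.one x, 𝒢.vecUnit c x⟩ : TangentBundle I G)) := hsm
    have hl := contMDiffOn_divL (𝒢 := 𝒢) (S := 𝒢.composable 0)
      (contMDiffOn_zero_along h0.contMDiffOn)
      (b := fun g => 𝒢.one (𝒢.s (g 0))) (v := fun g => vecUnit c (𝒢.s (g 0)))
      (hα.comp (𝒢.contMDiff_s.comp h0)).contMDiffOn
      (fun g _ => (𝒢.s_one _).symm) (fun g _ => left_compat hc (g 0))
    have hr := contMDiffOn_divL (𝒢 := 𝒢) (S := 𝒢.composable 0)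
      (a := fun g => 𝒢.one (𝒢.t (g 0))) (u := fun g => vecUnit c (𝒢.t (g 0)))
      (hα.comp (𝒢.contMDiff_t.comp h0)).contMDiffOn
      (contMDiffOn_zero_along (𝒢.smooth_inv.comp h0).contMDiffOn)
      (fun g _ => (𝒢.s_one _).trans (𝒢.s_inv (g 0)).symm) (fun g _ => right_compat hc (g 0))
    have hl' : ContMDiffOn (ModelWithCorners.pi fun _ : Fin 1 => I) I.tangent ∞
        (fun g : Fin 1 → G => (⟨g 0, 𝒢.divL (g 0) (𝒢.one (𝒢.s (g 0)))
          (0, vecUnit c (𝒢.s (g 0)))⟩ : TangentBundle I G)) (𝒢.composable 0) :=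
      hl.congr fun g _ => tangentBundle_mk_congr (by
        rw [𝒢.inv_one, 𝒢.mul_one]) rfl
    have hr' : ContMDiffOn (ModelWithCorners.pi fun _ : Fin 1 => I) I.tangent ∞
        (fun g : Fin 1 → G => (⟨g 0, 𝒢.divL (𝒢.one (𝒢.t (g 0))) (𝒢.inv (g 0))
          (vecUnit c (𝒢.t (g 0)), 0)⟩ : TangentBundle I G)) (𝒢.composable 0) :=
      hr.congr fun g _ => tangentBundle_mk_congr (by
        rw [Function.comp_apply, 𝒢.inv_inv, 𝒢.one_mul]) rfl
    refine (contMDiffOn_add_along hl' hr').congr fun g hg => tangentBundle_mk_congr rfl ?_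
    rw [extendZero_eq _ hg, vecTuple_diff_zero hc]
    rfl
  | succ n =>
    have h0 : ContMDiff (ModelWithCorners.pi fun _ : Fin (n + 2) => I) I ∞
      (fun g : Fin (n + 2) → G => g 0) := contMDiff_pi_eval 0
    have hface : ∀ j, ContMDiffOn (ModelWithCorners.pi fun _ : Fin (n + 2) => I) I.tangent ∞
        (fun g : Fin (n + 2) → G => (⟨𝒢.faceFun j g 0, 𝒢.extendZero c (𝒢.faceFun j g)⟩ :
          TangentBundle I G)) (𝒢.composable (n + 1)) := fun j =>
      ContMDiffOn.comp (t := 𝒢.composable n) hsm (contMDiffOn_faceFun 𝒢 j)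
        fun g hg => faceFun_mem j hg
    have hdrop : ContMDiffOn (ModelWithCorners.pi fun _ : Fin (n + 2) => I) I.tangent ∞
        (fun g : Fin (n + 2) → G => (⟨g 1, 𝒢.extendZero c (fun i => g i.succ)⟩ :
          TangentBundle I G)) (𝒢.composable (n + 1)) :=
      ContMDiffOn.comp (t := 𝒢.composable n) hsm (f := fun g : Fin (n + 2) → G => fun i => g i.succ)
        (fun g _ => ContMDiffWithinAt.pi_manifold fun i =>
          (contMDiff_pi_eval _).contMDiffAt.contMDiffWithinAt) fun g hg i =>
            (hg : g ∈ 𝒢.composable (n + 1)) i.succ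
    have hdiv := contMDiffOn_divL (hface 0) hdrop (fun g hg => s_face_zero ⟨g, hg⟩)
      (fun g hg => by
        have := tangentS_face_eq hc ⟨g, hg⟩
        rw [extendZero_eq c (faceFun_mem 0 hg), extendZero_eq c (fun i => hg i.succ)]
        exact this)
    have hdiv' : ContMDiffOn (ModelWithCorners.pi fun _ : Fin (n + 2) => I) I.tangent ∞
        (fun g : Fin (n + 2) → G => (⟨g 0, (-1 : ℝ) • 𝒢.divL (𝒢.faceFun 0 g 0) (g 1)
          (𝒢.extendZero c (𝒢.faceFun 0 g), 𝒢.extendZero c (fun i => g i.succ))⟩ :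
            TangentBundle I G)) (𝒢.composable (n + 1)) :=
      contMDiffOn_smul_along (-1) (hdiv.congr fun g hg =>
        tangentBundle_mk_congr (div_face_zero ⟨g, hg⟩).symm rfl)
    have hsum := contMDiffOn_sum_along (I := I) (b := fun g : Fin (n + 2) → G => g 0)
      (v := fun j g => (𝒢.extendZero c (𝒢.faceFun (j + 1) g) : E))
      (S := 𝒢.composable (n + 1)) (n + 1) h0.contMDiffOn
      (fun j => (hface (j + 1)).congr fun g hg =>
        tangentBundle_mk_congr (face_succ_zero j ⟨g, hg⟩).symm rfl)
    refine (contMDiffOn_add_along hdiv' hsum).congr fun g hg => tangentBundle_mk_congr rfl ?_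
    rw [extendZero_eq _ hg, vecTuple_diff]
    have e1 : divTerm c ⟨g, hg⟩ = 𝒢.divL (𝒢.faceFun 0 g 0) (g 1)
        (𝒢.extendZero c (𝒢.faceFun 0 g), 𝒢.extendZero c (fun i => g i.succ)) := by
      rw [extendZero_eq c (faceFun_mem 0 hg), extendZero_eq c (fun i => hg i.succ)]
      rfl
    have e2 : ∀ j, vecTuple c (face (j + 1) ⟨g, hg⟩) =
        (𝒢.extendZero c (𝒢.faceFun (j + 1) g) : E) := fun j =>
      (extendZero_eq c (faceFun_mem (j + 1) hg)).symm
    rw [e1]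
    simp_rw [e2]
    rw [← neg_one_smul ℝ (𝒢.divL _ _ _)]
    rfl

theorem diff_mem_defCochains {n : ℕ} {c : 𝒢.Cochain n} (hc : c ∈ 𝒢.defCochains n) :
    𝒢.diff n c ∈ 𝒢.defCochains (n + 1) := by
  rw [mem_defCochains] at hc ⊢
  exact ⟨hc.1.diff, hc.2.diff hc.1⟩

end Differential

end LieGroupoid

/-! ### Pull-back along automorphisms and pointwise limits. -/

namespace LieGroupoid

section Pullback

variable {E H E' H' : Type*} [NormedAddCommGroup E] [NormedSpace ℝ E]
  [TopologicalSpace H] [NormedAddCommGroup E'] [NormedSpace ℝ E'] [TopologicalSpace H']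
  {I : ModelWithCorners ℝ E H} {J : ModelWithCorners ℝ E' H'}
  {G M : Type u} [TopologicalSpace G] [ChartedSpace H G] [IsManifold I ∞ G]
  [TopologicalSpace M] [ChartedSpace H' M] [IsManifold J ∞ M]
  {𝒢 : LieGroupoid I J G M}

theorem vecTuple_pullback (Ψ : 𝒢.Aut) {n : ℕ} (c : 𝒢.Cochain (n + 1)) (g : 𝒢.composable n) :
    vecTuple (Ψ.pullback (n + 1) c) g =
      modelDeriv I I Ψ.invFun (Ψ.toFun (g.1 0)) (vecTuple c (Ψ.mapTuple g)) := rfl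

theorem Aut.mapTuple_face (Ψ : 𝒢.Aut) {n : ℕ} (j : ℕ) (g : 𝒢.composable (n + 1)) :
    Ψ.mapTuple (face j g) = face j (Ψ.mapTuple g) := by
  refine Subtype.ext (funext fun k => ?_)
  simp only [Aut.mapTuple, face, faceFun]
  split_ifs
  · rfl
  · exact Ψ.isHom.map_mul _ _ (g.2 k)
  · rfl

theorem Aut.mapTuple_apply (Ψ : 𝒢.Aut) {n : ℕ} (g : 𝒢.composable n) (i : Fin (n + 1)) :
    (Ψ.mapTuple g).1 i = Ψ.toFun (g.1 i) := rfl

variable [I.Boundaryless]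

theorem IsSourceCompatible.pullback (Ψ : 𝒢.Aut) {n : ℕ} {c : 𝒢.Cochain n}
    (hc : IsSourceCompatible c) : IsSourceCompatible (Ψ.pullback n c) := by
  cases n with
  | zero =>
    intro x
    have h := tangentS_modelDeriv Ψ.isHom_inv (𝒢.one (Ψ.base x)) (vecUnit c (Ψ.base x))
    rw [hc, map_zero, Ψ.inv_one_base] at h
    exact h
  | succ n =>
    intro g g' hg hs
    have h1 := tangentS_modelDeriv Ψ.isHom_inv (Ψ.toFun (g.1 0)) (vecTuple c (Ψ.mapTuple g))
    have h2 := tangentS_modelDeriv Ψ.isHom_inv (Ψ.toFun (g'.1 0)) (vecTuple c (Ψ.mapTuple g'))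
    have hs' : 𝒢.s (Ψ.toFun (g.1 0)) = 𝒢.s (Ψ.toFun (g'.1 0)) := by
      rw [Ψ.isHom.map_s, Ψ.isHom.map_s, hs]
    have h3 := hc (Ψ.mapTuple g) (Ψ.mapTuple g') (fun i => congrArg Ψ.toFun (hg i)) hs'
    rw [Aut.mapTuple_apply, Aut.mapTuple_apply] at h3
    rw [Ψ.left_inv, hs', h3] at h1
    rw [Ψ.left_inv] at h2
    exact h1.trans h2.symm

theorem diffUnit_pullback (Ψ : 𝒢.Aut) {α : 𝒢.Cochain 0} (hα : IsSourceCompatible α) (g : G) :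
    diffUnit (Ψ.pullback 0 α) g = modelDeriv I I Ψ.invFun (Ψ.toFun g) (diffUnit α (Ψ.toFun g)) := by
  have hg : ∀ g, Ψ.toFun g = 𝒢.mul (Ψ.toFun g) (𝒢.inv (𝒢.one (𝒢.s (Ψ.toFun g)))) := fun g => by
    rw [𝒢.inv_one, 𝒢.mul_one]
  have hg' : ∀ g, Ψ.toFun g = 𝒢.mul (𝒢.one (𝒢.t (Ψ.toFun g))) (𝒢.inv (𝒢.inv (Ψ.toFun g))) :=
    fun g => by rw [𝒢.inv_inv, 𝒢.one_mul]
  have h1 := modelDeriv_divL Ψ.isHom_inv (𝒢.s_one (𝒢.s (Ψ.toFun g))).symm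
    (left_compat hα (Ψ.toFun g))
  have h2 := modelDeriv_divL Ψ.isHom_inv ((𝒢.s_one (𝒢.t (Ψ.toFun g))).trans
    (𝒢.s_inv (Ψ.toFun g)).symm) (right_compat hα (Ψ.toFun g))
  rw [← hg, Ψ.left_inv, map_zero, Ψ.isHom.map_s, Ψ.inv_one_base] at h1
  rw [← hg', Ψ.isHom_inv.map_inv, Ψ.left_inv, map_zero, Ψ.isHom.map_t, Ψ.inv_one_base] at h2
  rw [diffUnit, diffUnit, map_add, Ψ.isHom.map_s, Ψ.isHom.map_t]
  exact congrArg₂ (· + ·) h1.symm h2.symm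

/-- The inverse automorphism is a morphism, so its tangent map commutes with that of division; the
face terms match because the automorphism preserves products. -/
theorem diff_pullback (Ψ : 𝒢.Aut) {n : ℕ} {c : 𝒢.Cochain n} (hc : IsSourceCompatible c) :
    𝒢.diff n (Ψ.pullback n c) = Ψ.pullback (n + 1) (𝒢.diff n c) := by
  refine cochain_ext_tuple fun g => ?_
  cases n with
  | zero =>
    rw [vecTuple_diff_zero (hc.pullback Ψ), vecTuple_pullback, vecTuple_diff_zero hc,
      diffUnit_pullback Ψ hc, Aut.mapTuple_apply]
  | succ n =>
    have h1 : divTerm (Ψ.pullback (n + 1) c) g =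
        modelDeriv I I Ψ.invFun (Ψ.toFun (g.1 0)) (divTerm c (Ψ.mapTuple g)) := by
      have h := modelDeriv_divL Ψ.isHom_inv (s_face_zero (Ψ.mapTuple g))
        (tangentS_face_eq hc (Ψ.mapTuple g))
      rw [div_face_zero, ← Aut.mapTuple_face, Aut.mapTuple_apply, Aut.mapTuple_apply,
        Aut.mapTuple_apply, Ψ.left_inv, Ψ.left_inv] at h
      rw [divTerm, divTerm, ← Aut.mapTuple_face]
      exact h.symm
    rw [vecTuple_diff, vecTuple_pullback, vecTuple_diff, h1, map_add, map_neg, map_sum]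
    congr 1
    refine Finset.sum_congr rfl fun j _ => ?_
    rw [vecTuple_pullback, map_smul, face_succ_zero, Aut.mapTuple_face]

end Pullback

section Limits

variable {E H E' H' : Type*} [NormedAddCommGroup E] [NormedSpace ℝ E]
  [TopologicalSpace H] [NormedAddCommGroup E'] [NormedSpace ℝ E'] [TopologicalSpace H']
  {I : ModelWithCorners ℝ E H} {J : ModelWithCorners ℝ E' H'}
  {G M : Type u} [TopologicalSpace G] [ChartedSpace H G] [IsManifold I ∞ G]
  [TopologicalSpace M] [ChartedSpace H' M] [IsManifold J ∞ M]
  {𝒢 : LieGroupoid I J G M} {ι : Type*} {l : Filter ι}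

/-- Pointwise convergence of cochains. -/
def TendstoPointwise {n : ℕ} (c : ι → 𝒢.Cochain n) (l : Filter ι) (d : 𝒢.Cochain n) : Prop :=
  ∀ p, Tendsto (fun r => 𝒢.vec (c r) p) l (𝓝 (𝒢.vec d p))

theorem TendstoPointwise.unit {c : ι → 𝒢.Cochain 0} {d : 𝒢.Cochain 0}
    (h : TendstoPointwise c l d) (x : M) :
    Tendsto (fun r => vecUnit (c r) x) l (𝓝 (vecUnit d x)) := h x

theorem TendstoPointwise.tuple {n : ℕ} {c : ι → 𝒢.Cochain (n + 1)} {d : 𝒢.Cochain (n + 1)}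
    (h : TendstoPointwise c l d) (g : 𝒢.composable n) :
    Tendsto (fun r => vecTuple (c r) g) l (𝓝 (vecTuple d g)) := h g

theorem TendstoPointwise.unique [l.NeBot] {n : ℕ} {c : ι → 𝒢.Cochain n} {d d' : 𝒢.Cochain n}
    (h : TendstoPointwise c l d) (h' : TendstoPointwise c l d') : d = d' :=
  funext fun p => tendsto_nhds_unique (X := E) (h p) (h' p)

theorem TendstoPointwise.add {n : ℕ} {c c' : ι → 𝒢.Cochain n} {d d' : 𝒢.Cochain n}
    (h : TendstoPointwise c l d) (h' : TendstoPointwise c' l d') :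
    TendstoPointwise (fun r => c r + c' r) l (d + d') :=
  fun p => (h p).add (h' p)

theorem TendstoPointwise.const_smul {n : ℕ} {c : ι → 𝒢.Cochain n} {d : 𝒢.Cochain n}
    (h : TendstoPointwise c l d) (a : ℝ) : TendstoPointwise (fun r => a • c r) l (a • d) :=
  fun p => Tendsto.const_smul (h p) a

theorem TendstoPointwise.pullback {n : ℕ} {c : ι → 𝒢.Cochain n} {d : 𝒢.Cochain n}
    (h : TendstoPointwise c l d) (Ψ : 𝒢.Aut) :
    TendstoPointwise (fun r => Ψ.pullback n (c r)) l (Ψ.pullback n d) := by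
  intro p
  cases n with
  | zero => exact ((modelDeriv I I Ψ.invFun _).continuous.tendsto _).comp (h.unit (Ψ.base p))
  | succ n => exact ((modelDeriv I I Ψ.invFun _).continuous.tendsto _).comp (h.tuple (Ψ.mapTuple p))

/-- The condition equates continuous linear functions of values at fixed points, hence is closed
under pointwise limits. -/
theorem TendstoPointwise.isSourceCompatible [l.NeBot] {n : ℕ} {c : ι → 𝒢.Cochain n}
    {d : 𝒢.Cochain n} (h : TendstoPointwise c l d) (hc : ∀ r, IsSourceCompatible (c r)) :
    IsSourceCompatible d := by
  cases n with
  | zero =>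
    intro x
    have h1 := ((𝒢.tangentS (𝒢.one x)).continuous.tendsto _).comp (h.unit x)
    refine tendsto_nhds_unique h1 ?_
    exact tendsto_const_nhds.congr fun r => (hc r x).symm
  | succ n =>
    intro g g' hg hs
    have h1 := ((𝒢.tangentS (g.1 0)).continuous.tendsto _).comp (h.tuple g)
    have h2 := ((𝒢.tangentS (g'.1 0)).continuous.tendsto _).comp (h.tuple g')
    exact tendsto_nhds_unique h1 (h2.congr fun r => (hc r g g' hg hs).symm)

/-- At a fixed tuple the differential is a continuous linear expression in finitely many values of
the cochain; no control on derivatives in the arguments is needed. -/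
theorem TendstoPointwise.diff [I.Boundaryless] [l.NeBot] {n : ℕ} {c : ι → 𝒢.Cochain n}
    {d : 𝒢.Cochain n} (h : TendstoPointwise c l d) (hc : ∀ r, IsSourceCompatible (c r)) :
    TendstoPointwise (fun r => 𝒢.diff n (c r)) l (𝒢.diff n d) := by
  have hd := h.isSourceCompatible hc
  have key : ∀ g : 𝒢.composable n, Tendsto (fun r => vecTuple (𝒢.diff n (c r)) g) l
      (𝓝 (vecTuple (𝒢.diff n d) g)) := by
    intro g
    cases n with
    | zero =>
      simp_rw [vecTuple_diff_zero (hc _), vecTuple_diff_zero hd, diffUnit]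
      exact (((𝒢.divL _ _).continuous.tendsto _).comp
        (tendsto_const_nhds.prodMk_nhds (h.unit _))).add
        (((𝒢.divL _ _).continuous.tendsto _).comp ((h.unit _).prodMk_nhds tendsto_const_nhds))
    | succ n =>
      simp_rw [vecTuple_diff, divTerm]
      refine Tendsto.add (Tendsto.neg (((𝒢.divL _ _).continuous.tendsto _).comp
        ((h.tuple _).prodMk_nhds (h.tuple _)))) (tendsto_finsetSum _ fun j _ => ?_)
      exact (h.tuple _).const_smul _
  exact key

theorem IsSourceCompatible.add_smul {n : ℕ} {c d : 𝒢.Cochain n} (hc : IsSourceCompatible c)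
    (hd : IsSourceCompatible d) (a b : ℝ) : IsSourceCompatible (a • c + b • d) := by
  cases n with
  | zero =>
    intro x
    have : vecUnit (a • c + b • d) x = a • vecUnit c x + b • vecUnit d x := rfl
    rw [this, map_add, map_smul, map_smul, hc, hd, smul_zero, smul_zero, add_zero]
  | succ n =>
    intro g g' hg hs
    have : ∀ g, vecTuple (a • c + b • d) g = a • vecTuple c g + b • vecTuple d g := fun _ => rfl
    rw [this, this, map_add, map_smul, map_smul, map_add, map_smul, map_smul, hc g g' hg hs,
      hd g g' hg hs]

end Limits

end LieGroupoid

/-! ### Tangent vectors and homotheties in bundle charts. -/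

section TangentCoordinates

variable {E H E₁ H₁ : Type*} [NormedAddCommGroup E] [NormedSpace ℝ E]
  [TopologicalSpace H] [NormedAddCommGroup E₁] [NormedSpace ℝ E₁] [TopologicalSpace H₁]
  {I : ModelWithCorners ℝ E H} {L : ModelWithCorners ℝ E₁ H₁}
  {G N : Type*} [TopologicalSpace G] [ChartedSpace H G] [IsManifold I ∞ G]
  [TopologicalSpace N] [ChartedSpace H₁ N]

theorem trivializationAt_tangent_snd {w₀ w : G} (hw : w ∈ (chartAt H w₀).source) (u : E) :
    (trivializationAt E (TangentSpace I : G → Type _) w₀ ⟨w, u⟩).2 =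
      modelDeriv I 𝓘(ℝ, E) (extChartAt I w₀) w u := by
  have h := TangentBundle.continuousLinearMapAt_trivializationAt (I := I) hw
  have h1 : (trivializationAt E (TangentSpace I : G → Type _) w₀).continuousLinearMapAt ℝ w u =
      (trivializationAt E (TangentSpace I : G → Type _) w₀ ⟨w, u⟩).2 :=
    congrFun (Trivialization.coe_linearMapAt_of_mem (R := ℝ)
      (trivializationAt E (TangentSpace I : G → Type _) w₀) (by simpa using hw)) u
  rw [← h1, h]
  rfl

/-- A vector field along a map `b` is smooth if `b` and the components of the field in a chart
are. -/
theorem contMDiffWithinAt_along_iff {b : N → G} {v : N → E} {S : Set N} {x₀ : N} {w₀ : G}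
    (hw : b x₀ ∈ (chartAt H w₀).source) :
    ContMDiffWithinAt L I.tangent ∞ (fun x => (⟨b x, v x⟩ : TangentBundle I G)) S x₀ ↔
      ContMDiffWithinAt L I ∞ b S x₀ ∧ ContMDiffWithinAt L 𝓘(ℝ, E) ∞
        (fun x => modelDeriv I 𝓘(ℝ, E) (extChartAt I w₀) (b x) (v x)) S x₀ := by
  have h := (trivializationAt E (TangentSpace I : G → Type _) w₀).contMDiffWithinAt_iff (IB := I)
    (IM := L) (n := ∞) (f := fun x => (⟨b x, v x⟩ : TangentBundle I G)) (s := S) (x₀ := x₀)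
    (by rw [Trivialization.mem_source]; simpa using hw)
  rw [h]
  refine and_congr_right fun hb => ?_
  have hev : ∀ᶠ x in 𝓝[S] x₀, b x ∈ (chartAt H w₀).source :=
    hb.continuousWithinAt ((chartAt H w₀).open_source.mem_nhds hw)
  refine Filter.EventuallyEq.contMDiffWithinAt_iff ?_ (trivializationAt_tangent_snd hw _)
  filter_upwards [hev] with x hx using trivializationAt_tangent_snd hx _

theorem modelDeriv_extChartAt_self (w : G) (u : E) :
    modelDeriv I 𝓘(ℝ, E) (extChartAt I w) w u = u := by
  have : IsManifold I 1 G := IsManifold.of_le (n := ∞) (by norm_cast)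
  have h := mfderiv_extChartAt_self (I := I) (x := w)
  exact congrArg (fun f : E →L[ℝ] E => f u) h

end TangentCoordinates

section FiberScaling

variable {EG HG : Type*} [NormedAddCommGroup EG] [NormedSpace ℝ EG] [TopologicalSpace HG]
  {IG : ModelWithCorners ℝ EG HG}
  {G : Type*} [TopologicalSpace G] [ChartedSpace HG G]
  {FW : Type*} [NormedAddCommGroup FW]
  {W : G → Type*} [∀ g, TopologicalSpace (W g)] [TopologicalSpace (TotalSpace FW W)]
  [FiberBundle FW W]

/-- Chart domains are full preimages of subsets of the base. Scaling, even by `0`, therefore never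
leaves them, and one chart can follow a point as `r → 0`. -/
theorem mem_chartAt_totalSpace_iff {w₀ w : TotalSpace FW W} :
    w ∈ (chartAt (ModelProd HG FW) w₀).source ↔
      w.proj ∈ (trivializationAt FW W w₀.proj).baseSet ∧ w.proj ∈ (chartAt HG w₀.proj).source := by
  rw [FiberBundle.chartedSpace_chartAt]
  simp only [mfld_simps]
  rw [Trivialization.mem_source]
  refine and_congr_right fun h => ?_
  rw [Trivialization.coe_fst' _ h]

variable [∀ g, AddCommGroup (W g)] [∀ g, Module ℝ (W g)]

theorem mem_chartAt_fiberSMul {w₀ w : TotalSpace FW W} (r : ℝ)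
    (hw : w ∈ (chartAt (ModelProd HG FW) w₀).source) :
    fiberSMul r w ∈ (chartAt (ModelProd HG FW) w₀).source :=
  mem_chartAt_totalSpace_iff.2 (mem_chartAt_totalSpace_iff (w := w).1 hw)

variable [NormedSpace ℝ FW] [VectorBundle ℝ FW W]

theorem trivializationAt_fiberSMul_snd {x₀ : G} (r : ℝ) {w : TotalSpace FW W}
    (hw : w.proj ∈ (trivializationAt FW W x₀).baseSet) :
    (trivializationAt FW W x₀ (fiberSMul r w)).2 = r • (trivializationAt FW W x₀ w).2 :=
  ((trivializationAt FW W x₀).linear ℝ hw).map_smul r w.2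

/-- Multiplication by `r` of the second component. -/
noncomputable def scaleSnd (EG FW : Type*) [NormedAddCommGroup EG] [NormedSpace ℝ EG]
    [NormedAddCommGroup FW] [NormedSpace ℝ FW] (r : ℝ) : EG × FW →L[ℝ] EG × FW :=
  (ContinuousLinearMap.id ℝ EG).prodMap (r • ContinuousLinearMap.id ℝ FW)

theorem scaleSnd_apply (r : ℝ) (p : EG × FW) : scaleSnd EG FW r p = (p.1, r • p.2) := rfl

theorem extChartAt_fiberSMul {w₀ w : TotalSpace FW W} (r : ℝ)
    (hw : w ∈ (chartAt (ModelProd HG FW) w₀).source) :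
    extChartAt (IG.prod 𝓘(ℝ, FW)) w₀ (fiberSMul r w) =
      scaleSnd EG FW r (extChartAt (IG.prod 𝓘(ℝ, FW)) w₀ w) := by
  have hw' : w.proj ∈ (trivializationAt FW W w₀.proj).baseSet :=
    (mem_chartAt_totalSpace_iff.1 hw).1
  have hw'' : (fiberSMul r w).proj ∈ (trivializationAt FW W w₀.proj).baseSet := hw'
  rw [FiberBundle.extChartAt]
  simp only [PartialEquiv.coe_trans, Function.comp_apply, PartialEquiv.prod_coe,
    PartialEquiv.refl_coe, id, scaleSnd_apply, OpenPartialHomeomorph.coe_toPartialEquiv,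
    Trivialization.coe_coe]
  refine Prod.ext ?_ (trivializationAt_fiberSMul_snd r hw')
  rw [Trivialization.coe_fst' _ hw', Trivialization.coe_fst' _ hw'']
  rfl

theorem contMDiff_fiberSMul_prod :
    ContMDiff (𝓘(ℝ, ℝ).prod (IG.prod 𝓘(ℝ, FW))) (IG.prod 𝓘(ℝ, FW)) ∞
      (fun p : ℝ × TotalSpace FW W => fiberSMul p.1 p.2) := by
  intro p₀
  have hp : ContMDiff (𝓘(ℝ, ℝ).prod (IG.prod 𝓘(ℝ, FW))) IG ∞
    (fun p : ℝ × TotalSpace FW W => p.2.proj) := (contMDiff_proj W).comp contMDiff_snd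
  have hid := (Bundle.contMDiffAt_totalSpace (F := FW) (E := W)).1
    (contMDiff_snd (I := 𝓘(ℝ, ℝ)) (J := IG.prod 𝓘(ℝ, FW)) (M := ℝ) (N := TotalSpace FW W)
      (n := ∞) p₀)
  refine Bundle.contMDiffAt_totalSpace.2 ⟨hp p₀, ?_⟩
  have hm : ∀ᶠ p in 𝓝 p₀, p.2.proj ∈ (trivializationAt FW W p₀.2.proj).baseSet :=
    hp.continuous.continuousAt ((trivializationAt FW W p₀.2.proj).open_baseSet.mem_nhds
      (mem_baseSet_trivializationAt FW W p₀.2.proj))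
  refine (contMDiffAt_fst.smul hid.2).congr_of_eventuallyEq ?_
  filter_upwards [hm] with p hp
  exact trivializationAt_fiberSMul_snd p.1 hp

theorem contMDiff_fiberSMul (r : ℝ) :
    ContMDiff (IG.prod 𝓘(ℝ, FW)) (IG.prod 𝓘(ℝ, FW)) ∞
      (fiberSMul r : TotalSpace FW W → TotalSpace FW W) :=
  contMDiff_fiberSMul_prod.comp (contMDiff_const.prodMk contMDiff_id)

/-- In the chart the homothety is the linear map `scaleSnd`, which is its own derivative. -/
theorem modelDeriv_extChartAt_fiberSMul [IsManifold IG ∞ G] [ContMDiffVectorBundle ∞ FW W IG]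
    [IG.Boundaryless] {w₀ w : TotalSpace FW W} (r : ℝ)
    (hw : w ∈ (chartAt (ModelProd HG FW) w₀).source) (u : EG × FW) :
    modelDeriv (IG.prod 𝓘(ℝ, FW)) 𝓘(ℝ, EG × FW) (extChartAt (IG.prod 𝓘(ℝ, FW)) w₀)
      (fiberSMul r w) (modelDeriv (IG.prod 𝓘(ℝ, FW)) (IG.prod 𝓘(ℝ, FW)) (fiberSMul r) w u) =
    scaleSnd EG FW r (modelDeriv (IG.prod 𝓘(ℝ, FW)) 𝓘(ℝ, EG × FW)
      (extChartAt (IG.prod 𝓘(ℝ, FW)) w₀) w u) := by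
  have : IsManifold IG 1 G := IsManifold.of_le (n := ∞) (by norm_cast)
  have hm : IsManifold (IG.prod 𝓘(ℝ, FW)) ∞ (TotalSpace FW W) :=
    Bundle.TotalSpace.isManifold FW W
  obtain ⟨γ, hγ⟩ := HasVelocity.exists_curve (I := IG.prod 𝓘(ℝ, FW)) w u
  have hχ : ∀ w ∈ (chartAt (ModelProd HG FW) w₀).source,
      MDifferentiableAt (IG.prod 𝓘(ℝ, FW)) 𝓘(ℝ, EG × FW) (extChartAt (IG.prod 𝓘(ℝ, FW)) w₀) w :=
    fun w hw => (contMDiffAt_extChartAt' (n := ∞) hw).mdifferentiableAt (by simp)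
  have h1 := (hγ.comp ((contMDiff_fiberSMul (IG := IG) (W := W) r w).mdifferentiableAt
    (by simp))).comp (hχ _ (mem_chartAt_fiberSMul r hw))
  have h2 := (hγ.comp (hχ w hw)).comp (f := scaleSnd EG FW r)
    (scaleSnd EG FW r).differentiableAt.mdifferentiableAt
  have h3 : modelDeriv 𝓘(ℝ, EG × FW) 𝓘(ℝ, EG × FW) (scaleSnd EG FW r)
      (extChartAt (IG.prod 𝓘(ℝ, FW)) w₀ w) = scaleSnd EG FW r := by
    rw [modelDeriv, mfderiv_eq_fderiv]
    exact (scaleSnd EG FW r).fderiv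
  rw [h3, ← extChartAt_fiberSMul r hw] at h2
  refine h1.unique (h2.congr ?_)
  filter_upwards [hγ.eventually ((chartAt (ModelProd HG FW) w₀).open_source.mem_nhds hw)] with τ hτ
  exact extChartAt_fiberSMul r hτ

end FiberScaling

namespace VBGroupoid

instance zeroPlus_neBot : zeroPlus.NeBot := by
  refine mem_closure_iff_comap_neBot.1 ?_
  rw [closure_Ioi]
  exact mem_Ici.2 le_rfl

theorem tendsto_val_zeroPlus : Tendsto (fun r : Ioi (0 : ℝ) => (r : ℝ)) zeroPlus (𝓝 0) :=
  tendsto_comap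

theorem tendsto_val_zeroPlus_ne : Tendsto (fun r : Ioi (0 : ℝ) => (r : ℝ)) zeroPlus (𝓝[≠] 0) :=
  tendsto_nhdsWithin_iff.2 ⟨tendsto_val_zeroPlus, Eventually.of_forall fun r => r.2.ne'⟩

end VBGroupoid

open VBGroupoid

/-! ### The expansion at `r = 0` and its coefficients. -/

section ScalingLimits

variable {EG FW : Type*} [NormedAddCommGroup EG] [NormedSpace ℝ EG]
  [NormedAddCommGroup FW] [NormedSpace ℝ FW]

/-- With `φ = (a, b)` the expression is `(r a(r), b(r))`. -/
theorem tendsto_smul_scaleSnd {φ : ℝ → EG × FW} (hφ : ContinuousAt φ 0) :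
    Tendsto (fun r : Ioi (0 : ℝ) => (r : ℝ) • scaleSnd EG FW (r : ℝ)⁻¹ (φ r)) zeroPlus
      (𝓝 (0, (φ 0).2)) := by
  have h := hφ.tendsto.comp tendsto_val_zeroPlus
  have h1 := tendsto_val_zeroPlus.smul ((continuous_fst.tendsto _).comp h)
  rw [zero_smul] at h1
  refine (h1.prodMk_nhds ((continuous_snd.tendsto _).comp h)).congr fun r => ?_
  refine Prod.ext rfl ?_
  exact (smul_inv_smul₀ r.2.ne' _).symm

/-- With `φ = (a, b)` the expression is `(a(r), r⁻¹ (b(r) - b(0)))`, whose second entry is a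
difference quotient. -/
theorem tendsto_scaleSnd_sub {φ : ℝ → EG × FW} (hφ : DifferentiableAt ℝ φ 0) :
    Tendsto (fun r : Ioi (0 : ℝ) => scaleSnd EG FW (r : ℝ)⁻¹ (φ r) - (r : ℝ)⁻¹ • (0, (φ 0).2))
      zeroPlus (𝓝 ((φ 0).1, deriv (fun r => (φ r).2) 0)) := by
  have h := hφ.continuousAt.tendsto.comp tendsto_val_zeroPlus
  have h2 := (hasDerivAt_iff_tendsto_slope_zero.1 hφ.snd.hasDerivAt).comp tendsto_val_zeroPlus_ne
  refine (((continuous_fst.tendsto _).comp h).prodMk_nhds h2).congr fun r => ?_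
  refine Prod.ext ?_ ?_
  · simp [scaleSnd_apply]
  · simp [scaleSnd_apply, smul_sub]

end ScalingLimits

section Linearization

variable {EG HG : Type*} [NormedAddCommGroup EG] [NormedSpace ℝ EG] [TopologicalSpace HG]
  {IG : ModelWithCorners ℝ EG HG} [IG.Boundaryless]
  {G : Type*} [TopologicalSpace G] [ChartedSpace HG G] [IsManifold IG ∞ G]
  {FW : Type*} [NormedAddCommGroup FW] [NormedSpace ℝ FW]
  {W : G → Type*} [∀ g, AddCommGroup (W g)] [∀ g, Module ℝ (W g)]
  [∀ g, TopologicalSpace (W g)] [TopologicalSpace (TotalSpace FW W)]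
  [FiberBundle FW W] [VectorBundle ℝ FW W] [ContMDiffVectorBundle ∞ FW W IG]
  {E₁ H₁ : Type*} [NormedAddCommGroup E₁] [NormedSpace ℝ E₁] [TopologicalSpace H₁]
  {L : ModelWithCorners ℝ E₁ H₁} {N : Type*} [TopologicalSpace N] [ChartedSpace H₁ N]

set_option maxHeartbeats 400000 in
/-- A vector field `v` along an `ℝ`-equivariant map `b : N → W` to the total space of a vector
bundle: the core and linear parts, i.e. the coefficients of `r⁻¹` and `1` in the expansion at
`r = 0` of the pull-back of `v` by the homothety `h_r`, exist and are smooth. -/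
theorem exists_core_linear_parts {S : Set N} {sc : ℝ → N → N} {b : N → TotalSpace FW W}
    {v : N → EG × FW}
    (hsc : ContMDiff (𝓘(ℝ, ℝ).prod L) L ∞ (fun p : ℝ × N => sc p.1 p.2))
    (hS : ∀ r, ∀ x ∈ S, sc r x ∈ S) (hb : ∀ r x, b (sc r x) = fiberSMul r (b x))
    (hv : ContMDiffOn L (IG.prod 𝓘(ℝ, FW)).tangent ∞
      (fun x => (⟨b x, v x⟩ : TangentBundle (IG.prod 𝓘(ℝ, FW)) (TotalSpace FW W))) S) :
    ∃ v₀ v₁ : N → EG × FW,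
      ContMDiffOn L (IG.prod 𝓘(ℝ, FW)).tangent ∞
        (fun x => (⟨b x, v₀ x⟩ : TangentBundle (IG.prod 𝓘(ℝ, FW)) (TotalSpace FW W))) S ∧
      ContMDiffOn L (IG.prod 𝓘(ℝ, FW)).tangent ∞
        (fun x => (⟨b x, v₁ x⟩ : TangentBundle (IG.prod 𝓘(ℝ, FW)) (TotalSpace FW W))) S ∧
      ∀ x ∈ S,
        Tendsto (fun r : Ioi (0 : ℝ) => (r : ℝ) • modelDeriv (IG.prod 𝓘(ℝ, FW))
          (IG.prod 𝓘(ℝ, FW)) (fiberSMul (r : ℝ)⁻¹) (b (sc r x)) (v (sc r x)))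
          zeroPlus (𝓝 (v₀ x)) ∧
        Tendsto (fun r : Ioi (0 : ℝ) => modelDeriv (IG.prod 𝓘(ℝ, FW))
          (IG.prod 𝓘(ℝ, FW)) (fiberSMul (r : ℝ)⁻¹) (b (sc r x)) (v (sc r x)) -
            (r : ℝ)⁻¹ • v₀ x) zeroPlus (𝓝 (v₁ x)) := by
  have : IsManifold IG 1 G := IsManifold.of_le (n := ∞) (by norm_cast)
  have hm : IsManifold (IG.prod 𝓘(ℝ, FW)) ∞ (TotalSpace FW W) :=
    Bundle.TotalSpace.isManifold FW W
  let K : TotalSpace FW W → TotalSpace FW W → (EG × FW →L[ℝ] EG × FW) := fun w₀ w =>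
    modelDeriv (IG.prod 𝓘(ℝ, FW)) 𝓘(ℝ, EG × FW) (extChartAt (IG.prod 𝓘(ℝ, FW)) w₀) w
  let Φ : TotalSpace FW W → ℝ × N → EG × FW := fun w₀ p =>
    K w₀ (b (sc p.1 p.2)) (v (sc p.1 p.2))
  let P : ℝ → N → EG × FW := fun r x =>
    modelDeriv (IG.prod 𝓘(ℝ, FW)) (IG.prod 𝓘(ℝ, FW)) (fiberSMul r⁻¹) (b (sc r x)) (v (sc r x))
  -- In the chart at `w₀` the pull-back is singular at `r = 0` only through the explicit factor
  -- `scaleSnd r⁻¹`; `Φ` itself is smooth there.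
  have hKP : ∀ w₀ (r : Ioi (0 : ℝ)) x, b x ∈ (chartAt (ModelProd HG FW) w₀).source →
      K w₀ (b x) (P r x) = scaleSnd EG FW (r : ℝ)⁻¹ (Φ w₀ (r, x)) := by
    intro w₀ r x hx
    have h := modelDeriv_extChartAt_fiberSMul (IG := IG) (w₀ := w₀) (w := b (sc r x)) (r : ℝ)⁻¹
      (by rw [hb]; exact mem_chartAt_fiberSMul _ hx) (v (sc r x))
    have h' : fiberSMul (r : ℝ)⁻¹ (b (sc r x)) = b x := by
      rw [hb, fiberSMul_cancel (inv_mul_cancel₀ r.2.ne')]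
    rw [h'] at h
    exact h
  have hΦ : ∀ w₀, ∀ x ∈ S, b x ∈ (chartAt (ModelProd HG FW) w₀).source →
      ContMDiffWithinAt (𝓘(ℝ, ℝ).prod L) 𝓘(ℝ, EG × FW) ∞ (Φ w₀) (univ ×ˢ S) (0, x) := by
    intro w₀ x hx hbx
    have h := (hv (sc 0 x) (hS 0 x hx)).comp (0, x) (hsc (0, x)).contMDiffWithinAt
      (s := univ ×ˢ S) (fun p hp => hS p.1 p.2 hp.2)
    exact ((contMDiffWithinAt_along_iff (b := fun p : ℝ × N => b (sc p.1 p.2))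
      (v := fun p : ℝ × N => v (sc p.1 p.2)) (w₀ := w₀)
      (by simp only [hb]; exact mem_chartAt_fiberSMul _ hbx)).1 h).2
  have hdiff : ∀ w₀, ∀ x ∈ S, b x ∈ (chartAt (ModelProd HG FW) w₀).source →
      DifferentiableAt ℝ (fun r => Φ w₀ (r, x)) 0 := by
    intro w₀ x hx hbx
    have h := (hΦ w₀ x hx hbx).comp (0 : ℝ) (s := univ) (f := fun r : ℝ => (r, x))
      (contMDiffAt_id.prodMk contMDiffAt_const).contMDiffWithinAt (fun r _ => ⟨trivial, hx⟩)
    exact (contMDiffAt_iff_contDiffAt.1 (contMDiffWithinAt_univ.1 h)).differentiableAt (by simp)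
  -- The coefficients are read in the chart centred at `b x`, whose derivative at `b x` is the
  -- identity.
  let v₀ : N → EG × FW := fun x => (0, (Φ (b x) (0, x)).2)
  let v₁ : N → EG × FW := fun x =>
    ((Φ (b x) (0, x)).1, deriv (fun r => (Φ (b x) (r, x)).2) 0)
  have hself : ∀ x, b x ∈ (chartAt (ModelProd HG FW) (b x)).source := fun x => mem_chart_source _ _
  have hP : ∀ (r : Ioi (0 : ℝ)) x, P r x = scaleSnd EG FW (r : ℝ)⁻¹ (Φ (b x) (r, x)) :=
    fun r x => (modelDeriv_extChartAt_self (b x) (P r x)).symm.trans (hKP (b x) r x (hself x))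
  have hlim₀ : ∀ x ∈ S, Tendsto (fun r : Ioi (0 : ℝ) => (r : ℝ) • P r x) zeroPlus (𝓝 (v₀ x)) := by
    intro x hx
    simp only [hP]
    exact tendsto_smul_scaleSnd (φ := fun r => Φ (b x) (r, x))
      (hdiff (b x) x hx (hself x)).continuousAt
  have hlim₁ : ∀ x ∈ S, Tendsto (fun r : Ioi (0 : ℝ) => P r x - (r : ℝ)⁻¹ • v₀ x) zeroPlus
      (𝓝 (v₁ x)) := by
    intro x hx
    simp only [hP]
    exact tendsto_scaleSnd_sub (φ := fun r => Φ (b x) (r, x)) (hdiff (b x) x hx (hself x))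
  -- Smoothness must be tested in one chart valid for all nearby points, whereas `v₀` and `v₁` use a
  -- chart varying with `x`. Uniqueness of limits carries the formulas over to an arbitrary chart.
  have hK₀ : ∀ w₀, ∀ x ∈ S, b x ∈ (chartAt (ModelProd HG FW) w₀).source →
      K w₀ (b x) (v₀ x) = (0, (Φ w₀ (0, x)).2) := by
    intro w₀ x hx hbx
    refine tendsto_nhds_unique (((K w₀ (b x)).continuous.tendsto _).comp (hlim₀ x hx)) ?_
    refine (tendsto_smul_scaleSnd (φ := fun r => Φ w₀ (r, x))
      (hdiff w₀ x hx hbx).continuousAt).congr fun r => ?_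
    rw [Function.comp_apply, map_smul, hKP w₀ r x hbx]
  have hK₁ : ∀ w₀, ∀ x ∈ S, b x ∈ (chartAt (ModelProd HG FW) w₀).source →
      K w₀ (b x) (v₁ x) = ((Φ w₀ (0, x)).1, deriv (fun r => (Φ w₀ (r, x)).2) 0) := by
    intro w₀ x hx hbx
    refine tendsto_nhds_unique (((K w₀ (b x)).continuous.tendsto _).comp (hlim₁ x hx)) ?_
    refine (tendsto_scaleSnd_sub (φ := fun r => Φ w₀ (r, x)) (hdiff w₀ x hx hbx)).congr fun r => ?_
    rw [Function.comp_apply, map_sub, map_smul, hKP w₀ r x hbx, hK₀ w₀ x hx hbx]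
  have hbS : ∀ x ∈ S, ContMDiffWithinAt L (IG.prod 𝓘(ℝ, FW)) ∞ b S x := fun x hx =>
    ((contMDiffWithinAt_along_iff (hself x)).1 (hv x hx)).1
  have hev : ∀ x ∈ S, ∀ᶠ y in 𝓝[S] x, y ∈ S ∧ b y ∈ (chartAt (ModelProd HG FW) (b x)).source :=
    fun x hx => (eventually_mem_nhdsWithin).and ((hbS x hx).continuousWithinAt
      ((chartAt (ModelProd HG FW) (b x)).open_source.mem_nhds (hself x)))
  have hslice : ∀ x ∈ S, ContMDiffWithinAt L 𝓘(ℝ, EG × FW) ∞ (fun y => Φ (b x) (0, y)) S x :=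
    fun x hx => (hΦ (b x) x hx (hself x)).comp x (f := fun y => ((0 : ℝ), y))
      (contMDiffAt_const.prodMk contMDiffAt_id).contMDiffWithinAt (fun y hy => ⟨trivial, hy⟩)
  have hsnd : ContMDiff 𝓘(ℝ, EG × FW) 𝓘(ℝ, FW) ∞ (Prod.snd : EG × FW → FW) :=
    contDiff_snd.contMDiff
  have hfst : ContMDiff 𝓘(ℝ, EG × FW) 𝓘(ℝ, EG) ∞ (Prod.fst : EG × FW → EG) :=
    contDiff_fst.contMDiff
  refine ⟨v₀, v₁, fun x hx => ?_, fun x hx => ?_, fun x hx => ⟨hlim₀ x hx, hlim₁ x hx⟩⟩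
  · refine (contMDiffWithinAt_along_iff (w₀ := b x) (hself x)).2 ⟨hbS x hx, ?_⟩
    refine ContMDiffWithinAt.congr_of_eventuallyEq (ContMDiffWithinAt.prodMk_space
      contMDiffWithinAt_const (hsnd.contMDiffAt.comp_contMDiffWithinAt x (hslice x hx)))
      ?_ (hK₀ (b x) x hx (hself x))
    filter_upwards [hev x hx] with y hy using hK₀ (b x) y hy.1 hy.2
  · refine (contMDiffWithinAt_along_iff (w₀ := b x) (hself x)).2 ⟨hbS x hx, ?_⟩
    refine ContMDiffWithinAt.congr_of_eventuallyEq (ContMDiffWithinAt.prodMk_space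
      (hfst.contMDiffAt.comp_contMDiffWithinAt x (hslice x hx))
      (ContMDiffWithinAt.deriv_param hx
        (hsnd.contMDiffAt.comp_contMDiffWithinAt (0, x) (hΦ (b x) x hx (hself x)))))
      ?_ (hK₁ (b x) x hx (hself x))
    filter_upwards [hev x hx] with y hy using hK₁ (b x) y hy.1 hy.2

end Linearization

theorem LinearMap.isCompl_range_ker_of_comp_eq_id {R M N : Type*} [Ring R] [AddCommGroup M]
    [AddCommGroup N] [Module R M] [Module R N] {f : N →ₗ[R] M} {g : M →ₗ[R] N}
    (h : f ∘ₗ g = LinearMap.id) : IsCompl (LinearMap.range g) (LinearMap.ker f) := by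
  have h' : ∀ x, f (g x) = x := LinearMap.congr_fun h
  refine ⟨Submodule.disjoint_def.2 ?_, Submodule.codisjoint_iff_exists_add_eq.2 fun y =>
    ⟨g (f y), y - g (f y), ⟨f y, rfl⟩, ?_, add_sub_cancel _ _⟩⟩
  · rintro _ ⟨x, rfl⟩ hx
    rw [LinearMap.mem_ker, h'] at hx
    rw [hx, map_zero]
  · rw [LinearMap.mem_ker, map_sub, h', sub_self]

theorem fiberSMul_mul {B F : Type*} {V : B → Type*} [∀ x, AddCommGroup (V x)]
    [∀ x, Module ℝ (V x)] (a b : ℝ) (w : TotalSpace F V) :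
    fiberSMul (a * b) w = fiberSMul a (fiberSMul b w) := by
  unfold fiberSMul
  rw [mul_smul]

section FiberScaling

variable {EG HG : Type*} [NormedAddCommGroup EG] [NormedSpace ℝ EG] [TopologicalSpace HG]
  {IG : ModelWithCorners ℝ EG HG}
  {G : Type*} [TopologicalSpace G] [ChartedSpace HG G]
  {FW : Type*} [NormedAddCommGroup FW] [NormedSpace ℝ FW]
  {W : G → Type*} [∀ g, AddCommGroup (W g)] [∀ g, Module ℝ (W g)]
  [∀ g, TopologicalSpace (W g)] [TopologicalSpace (TotalSpace FW W)]
  [FiberBundle FW W] [VectorBundle ℝ FW W]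

theorem modelDeriv_fiberSMul_mul (a b : ℝ) (w : TotalSpace FW W) (u : EG × FW) :
    modelDeriv (IG.prod 𝓘(ℝ, FW)) (IG.prod 𝓘(ℝ, FW)) (fiberSMul (a * b)) w u =
      modelDeriv (IG.prod 𝓘(ℝ, FW)) (IG.prod 𝓘(ℝ, FW)) (fiberSMul a) (fiberSMul b w)
        (modelDeriv (IG.prod 𝓘(ℝ, FW)) (IG.prod 𝓘(ℝ, FW)) (fiberSMul b) w u) := by
  have h : (fiberSMul (a * b) : TotalSpace FW W → TotalSpace FW W) =
      fiberSMul a ∘ fiberSMul b := funext (fiberSMul_mul a b)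
  have h1 := mfderiv_comp w
    ((contMDiff_fiberSMul (IG := IG) (W := W) a (fiberSMul b w)).mdifferentiableAt (by simp))
    ((contMDiff_fiberSMul (IG := IG) (W := W) b w).mdifferentiableAt (by simp))
  rw [h]
  exact congrArg (fun f : EG × FW →L[ℝ] EG × FW => f u) h1

theorem contMDiff_fiberSMul_tuple (n : ℕ) :
    ContMDiff (𝓘(ℝ, ℝ).prod (ModelWithCorners.pi fun _ : Fin n => IG.prod 𝓘(ℝ, FW)))
      (ModelWithCorners.pi fun _ : Fin n => IG.prod 𝓘(ℝ, FW)) ∞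
      (fun p : ℝ × (Fin n → TotalSpace FW W) => fun i => fiberSMul p.1 (p.2 i)) := by
  intro p
  refine contMDiffWithinAt_univ.1 (ContMDiffWithinAt.pi_manifold fun i => ?_)
  exact ((contMDiff_fiberSMul_prod (IG := IG) (W := W)).comp
    (contMDiff_fst.prodMk ((contMDiff_pi_eval i).comp contMDiff_snd)) p).contMDiffWithinAt

end FiberScaling

/-! ### Linearization of cochains on a VB-groupoid. -/

namespace VBGroupoid

open LieGroupoid

variable {EG HG EM HM : Type*} [NormedAddCommGroup EG] [NormedSpace ℝ EG]
  [TopologicalSpace HG] [NormedAddCommGroup EM] [NormedSpace ℝ EM] [TopologicalSpace HM]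
  {IG : ModelWithCorners ℝ EG HG} {IM : ModelWithCorners ℝ EM HM}
  {G M : Type u} [TopologicalSpace G] [ChartedSpace HG G] [IsManifold IG ∞ G]
  [TopologicalSpace M] [ChartedSpace HM M] [IsManifold IM ∞ M]
  {FW : Type*} [NormedAddCommGroup FW] [NormedSpace ℝ FW]
  {W : G → Type u} [∀ g, AddCommGroup (W g)] [∀ g, Module ℝ (W g)]
  [∀ g, TopologicalSpace (W g)] [TopologicalSpace (TotalSpace FW W)]
  [FiberBundle FW W] [VectorBundle ℝ FW W] [ContMDiffVectorBundle ∞ FW W IG]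
  {FE : Type*} [NormedAddCommGroup FE] [NormedSpace ℝ FE]
  {E : M → Type u} [∀ x, AddCommGroup (E x)] [∀ x, Module ℝ (E x)]
  [∀ x, TopologicalSpace (E x)] [TopologicalSpace (TotalSpace FE E)]
  [FiberBundle FE E] [VectorBundle ℝ FE E] [ContMDiffVectorBundle ∞ FE E IM]
  {V : VBGroupoid IG IM FW W FE E}

theorem isLinearization_iff {n : ℕ} {c c₁ : V.total.Cochain n} :
    V.IsLinearization c c₁ ↔ ∃ c₀ ∈ V.defCochains n,
      TendstoPointwise (fun r : Ioi (0 : ℝ) => (r : ℝ) • V.hpull r n c) zeroPlus c₀ ∧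
      TendstoPointwise (fun r : Ioi (0 : ℝ) => V.hpull r n c - (r : ℝ)⁻¹ • c₀) zeroPlus c₁ :=
  Iff.rfl

theorem composable_fiberSMul (r : ℝ) {n : ℕ} {g : Fin (n + 1) → TotalSpace FW W}
    (hg : g ∈ V.total.composable n) : (fun i => fiberSMul r (g i)) ∈ V.total.composable n :=
  fun i => by rw [(V.smul_hom r).map_s, (V.smul_hom r).map_t, hg i]

theorem IsLinearization.unique {n : ℕ} {c d d' : V.total.Cochain n} (h : V.IsLinearization c d)
    (h' : V.IsLinearization c d') : d = d' := by
  obtain ⟨c₀, -, h₀, h₁⟩ := isLinearization_iff.1 h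
  obtain ⟨c₀', -, h₀', h₁'⟩ := isLinearization_iff.1 h'
  obtain rfl := h₀.unique h₀'
  exact h₁.unique h₁'

theorem IsLinearization.add_smul {n : ℕ} {c c' d d' : V.total.Cochain n} (a a' : ℝ)
    (h : V.IsLinearization c d) (h' : V.IsLinearization c' d') :
    V.IsLinearization (a • c + a' • c') (a • d + a' • d') := by
  obtain ⟨c₀, hc₀, h₀, h₁⟩ := isLinearization_iff.1 h
  obtain ⟨c₀', hc₀', h₀', h₁'⟩ := isLinearization_iff.1 h'
  refine isLinearization_iff.2 ⟨a • c₀ + a' • c₀', add_mem (Submodule.smul_mem _ _ hc₀)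
    (Submodule.smul_mem _ _ hc₀'), ?_, ?_⟩
  · convert (h₀.const_smul a).add (h₀'.const_smul a') using 2 with r
    rw [map_add, map_smul, map_smul]
    module
  · convert (h₁.const_smul a).add (h₁'.const_smul a') using 2 with r
    rw [map_add, map_smul, map_smul]
    module

/-- For an invariant cochain `r • h_r^* c = r • c` tends to `0`, so the core vanishes and the second
limit is constant. -/
theorem isLinearization_self {n : ℕ} {c : V.total.Cochain n} (hc : c ∈ V.linCochains n) :
    V.IsLinearization c c := by
  refine isLinearization_iff.2 ⟨0, zero_mem _, fun p => ?_, fun p => ?_⟩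
  · simp only [hc.2]
    have h := tendsto_val_zeroPlus.smul_const (V.total.vec c p)
    rw [zero_smul] at h
    exact h
  · simp only [hc.2, smul_zero, sub_zero]
    exact tendsto_const_nhds

/-- Multiplication of positive real numbers. -/
def mulPos (r μ : Ioi (0 : ℝ)) : Ioi (0 : ℝ) :=
  ⟨(r : ℝ) * (μ : ℝ), mem_Ioi.2 (mul_pos (mem_Ioi.1 r.2) (mem_Ioi.1 μ.2))⟩

theorem tendsto_mulPos (μ : Ioi (0 : ℝ)) : Tendsto (fun r => mulPos r μ) zeroPlus zeroPlus := by
  refine tendsto_comap_iff.2 ?_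
  have h := tendsto_val_zeroPlus.mul_const (μ : ℝ)
  rwa [zero_mul] at h

theorem hpull_hpull (r μ : Ioi (0 : ℝ)) {n : ℕ} (c : V.total.Cochain n) :
    V.hpull μ n (V.hpull r n c) = V.hpull (mulPos r μ) n c := by
  have hinv : ((mulPos r μ : Ioi (0 : ℝ)) : ℝ)⁻¹ = (μ : ℝ)⁻¹ * (r : ℝ)⁻¹ := mul_inv_rev _ _
  cases n with
  | zero =>
    refine funext fun x => ?_
    have hx : (V.homothety (mulPos r μ)).base x = fiberSMul (r : ℝ) (fiberSMul (μ : ℝ) x) :=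
      fiberSMul_mul _ _ _
    have h1 : (fiberSMul (r : ℝ)⁻¹ (V.total.one (fiberSMul (r : ℝ) (fiberSMul (μ : ℝ) x)))) =
        V.total.one (fiberSMul (μ : ℝ) x) := by
      rw [← (V.smul_hom _).map_one, fiberSMul_cancel (inv_mul_cancel₀ r.2.ne')]
    have h2 : vecUnit (V.hpull (mulPos r μ) 0 c) x = modelDeriv (IG.prod 𝓘(ℝ, FW))
        (IG.prod 𝓘(ℝ, FW)) (fiberSMul (mulPos r μ : ℝ)⁻¹)
        (V.total.one ((V.homothety (mulPos r μ)).base x))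
        (vecUnit c ((V.homothety (mulPos r μ)).base x)) := rfl
    rw [hx, hinv, modelDeriv_fiberSMul_mul, h1] at h2
    exact h2.symm
  | succ n =>
    refine cochain_ext_tuple fun g => ?_
    have hg : (V.homothety (mulPos r μ)).mapTuple g =
        (V.homothety r).mapTuple ((V.homothety μ).mapTuple g) :=
      Subtype.ext (funext fun i => fiberSMul_mul _ _ _)
    have hg0 : (V.homothety (mulPos r μ)).toFun (g.1 0) =
        fiberSMul (r : ℝ) (fiberSMul (μ : ℝ) (g.1 0)) := fiberSMul_mul _ _ _
    have h2 : vecTuple (V.hpull (mulPos r μ) (n + 1) c) g = modelDeriv (IG.prod 𝓘(ℝ, FW))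
        (IG.prod 𝓘(ℝ, FW)) (fiberSMul (mulPos r μ : ℝ)⁻¹)
        ((V.homothety (mulPos r μ)).toFun (g.1 0))
        (vecTuple c ((V.homothety (mulPos r μ)).mapTuple g)) := rfl
    rw [hg, hg0, hinv, modelDeriv_fiberSMul_mul,
      fiberSMul_cancel (inv_mul_cancel₀ r.2.ne')] at h2
    exact h2.symm

/-- Substituting `r μ` for `r` in the first limit shows that the core is homogeneous of degree `-1`.
The correction `r⁻¹ c₀` then pulls back to `(r μ)⁻¹ c₀`, and the same substitution in the second
limit gives invariance. -/
theorem IsLinearization.hpull_eq {n : ℕ} {c c₁ : V.total.Cochain n} (h : V.IsLinearization c c₁)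
    (μ : Ioi (0 : ℝ)) : V.hpull μ n c₁ = c₁ := by
  obtain ⟨c₀, -, h₀, h₁⟩ := isLinearization_iff.1 h
  have hμ : (μ : ℝ) ≠ 0 := μ.2.ne'
  have hcore : V.hpull μ n c₀ = (μ : ℝ)⁻¹ • c₀ := by
    refine (h₀.pullback (V.homothety μ)).unique (l := zeroPlus) ?_
    have h2 : TendstoPointwise (fun r : Ioi (0 : ℝ) => (mulPos r μ : ℝ) •
        V.hpull (mulPos r μ) n c) zeroPlus c₀ := fun p => (h₀ p).comp (tendsto_mulPos μ)
    convert h2.const_smul (μ : ℝ)⁻¹ using 2 with r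
    change V.hpull μ n _ = _
    rw [map_smul, hpull_hpull, smul_smul]
    congr 1
    change (r : ℝ) = (μ : ℝ)⁻¹ * (r * μ)
    field_simp
  refine (h₁.pullback (V.homothety μ)).unique (l := zeroPlus) ?_
  have h2 : TendstoPointwise (fun r : Ioi (0 : ℝ) => V.hpull (mulPos r μ) n c -
      (mulPos r μ : ℝ)⁻¹ • c₀) zeroPlus c₁ := fun p => (h₁ p).comp (tendsto_mulPos μ)
  convert h2 using 2 with r
  change V.hpull μ n _ = _
  rw [map_sub, map_smul, hpull_hpull, hcore, smul_smul]
  congr 2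
  exact (_root_.mul_inv _ _).symm

variable [IG.Boundaryless]

theorem exists_smooth_core_linear_parts {n : ℕ} {c : V.total.Cochain n} (hc : IsSmoothCochain c) :
    ∃ c₀ c₁ : V.total.Cochain n, IsSmoothCochain c₀ ∧ IsSmoothCochain c₁ ∧
      TendstoPointwise (fun r : Ioi (0 : ℝ) => (r : ℝ) • V.hpull r n c) zeroPlus c₀ ∧
      TendstoPointwise (fun r : Ioi (0 : ℝ) => V.hpull r n c - (r : ℝ)⁻¹ • c₀) zeroPlus c₁ := by
  cases n with
  | zero =>
    -- Here the field lives along the unit map, which is equivariant because scaling is a groupoid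
    -- morphism; in the other degrees it lives along the first arrow of a tuple.
    obtain ⟨v₀, v₁, h₀, h₁, h⟩ := exists_core_linear_parts (S := univ) (sc := fiberSMul)
      (b := V.total.one) (v := vecUnit c) (contMDiff_fiberSMul_prod (IG := IM) (W := E))
      (fun _ _ _ => trivial) (fun r x => ((V.smul_hom r).map_one x).symm) (contMDiffOn_univ.2 hc)
    exact ⟨v₀, v₁, contMDiffOn_univ.1 h₀, contMDiffOn_univ.1 h₁, fun x => (h x trivial).1,
      fun x => (h x trivial).2⟩
  | succ n =>
    obtain ⟨v₀, v₁, h₀, h₁, h⟩ := exists_core_linear_parts (S := V.total.composable n)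
      (sc := fun r g i => fiberSMul r (g i)) (b := fun g => g 0) (v := V.total.extendZero c)
      (contMDiff_fiberSMul_tuple (n + 1)) (fun r _ hg => composable_fiberSMul r hg)
      (fun _ _ => rfl) hc
    have hr : ∀ (r : Ioi (0 : ℝ)) (g : V.total.composable n),
        vecTuple (V.hpull r (n + 1) c) g = modelDeriv (IG.prod 𝓘(ℝ, FW)) (IG.prod 𝓘(ℝ, FW))
          (fiberSMul (r : ℝ)⁻¹) (fiberSMul (r : ℝ) (g.1 0))
          (V.total.extendZero c fun i => fiberSMul (r : ℝ) (g.1 i)) := by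
      intro r g
      have h := extendZero_eq c (composable_fiberSMul (r : ℝ) g.2)
      exact congrArg _ h.symm
    refine ⟨fun g => v₀ g.1, fun g => v₁ g.1, h₀.congr fun g hg => ?_, h₁.congr fun g hg => ?_,
      fun g => (h g.1 g.2).1.congr fun r => ?_, fun g => (h g.1 g.2).2.congr fun r => ?_⟩
    · exact tangentBundle_mk_congr rfl (V.total.extendZero_of_mem hg)
    · exact tangentBundle_mk_congr rfl (V.total.extendZero_of_mem hg)
    · exact congrArg ((r : ℝ) • ·) (hr r g).symm
    · exact congrArg (· - (r : ℝ)⁻¹ • v₀ g.1) (hr r g).symm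

theorem isSourceCompatible_hpull {n : ℕ} {c : V.total.Cochain n} (hc : IsSourceCompatible c)
    (r : Ioi (0 : ℝ)) : IsSourceCompatible (V.hpull r n c) := hc.pullback _

theorem diff_hpull {n : ℕ} {c : V.total.Cochain n} (hc : IsSourceCompatible c)
    (r : Ioi (0 : ℝ)) :
    V.total.diff n (V.hpull r n c) = V.hpull r (n + 1) (V.total.diff n c) := diff_pullback _ hc

theorem isSourceCompatible_smul_hpull {n : ℕ} {c : V.total.Cochain n}
    (hc : IsSourceCompatible c) (r : Ioi (0 : ℝ)) :
    IsSourceCompatible ((r : ℝ) • V.hpull r n c) := by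
  have h := (isSourceCompatible_hpull hc r).add_smul hc (r : ℝ) 0
  rwa [zero_smul, add_zero] at h

theorem isSourceCompatible_hpull_sub {n : ℕ} {c c₀ : V.total.Cochain n}
    (hc : IsSourceCompatible c) (hc₀ : IsSourceCompatible c₀) (r : Ioi (0 : ℝ)) :
    IsSourceCompatible (V.hpull r n c - (r : ℝ)⁻¹ • c₀) := by
  have h := (isSourceCompatible_hpull hc r).add_smul hc₀ 1 (-(r : ℝ)⁻¹)
  rwa [one_smul, neg_smul, ← sub_eq_add_neg] at h

theorem exists_isLinearization {n : ℕ} {c : V.total.Cochain n} (hc : c ∈ V.defCochains n) :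
    ∃ c₁ ∈ V.defCochains n, V.IsLinearization c c₁ := by
  obtain ⟨hs, hsm⟩ := mem_defCochains.1 hc
  obtain ⟨c₀, c₁, h₀, h₁, hl₀, hl₁⟩ := exists_smooth_core_linear_parts hsm
  have hs₀ := hl₀.isSourceCompatible (isSourceCompatible_smul_hpull hs)
  have hs₁ := hl₁.isSourceCompatible (isSourceCompatible_hpull_sub hs hs₀)
  exact ⟨c₁, mem_defCochains.2 ⟨hs₁, h₁⟩, c₀, mem_defCochains.2 ⟨hs₀, h₀⟩, hl₀, hl₁⟩

/-- Both limits pass through the differential, which commutes with the homotheties; in particular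
the core of `δc` is `δ` of the core of `c`. -/
theorem IsLinearization.diff {n : ℕ} {c c₁ : V.total.Cochain n} (h : V.IsLinearization c c₁)
    (hc : c ∈ V.defCochains n) :
    V.IsLinearization (V.total.diff n c) (V.total.diff n c₁) := by
  obtain ⟨c₀, hc₀, h₀, h₁⟩ := isLinearization_iff.1 h
  have hs := (mem_defCochains.1 hc).1
  have hs₀ := (mem_defCochains.1 hc₀).1
  refine isLinearization_iff.2 ⟨V.total.diff n c₀, diff_mem_defCochains hc₀, ?_, ?_⟩
  · convert h₀.diff (isSourceCompatible_smul_hpull hs) using 2 with r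
    rw [map_smul, diff_hpull hs]
  · convert h₁.diff (isSourceCompatible_hpull_sub hs hs₀) using 2 with r
    rw [map_sub, map_smul, diff_hpull hs]

theorem exists_linearization_mem_linCochains {n : ℕ} (c : V.defCochains n) :
    ∃ c₁ : V.linCochains n, V.IsLinearization c.1 c₁.1 := by
  obtain ⟨c₁, hc₁, h⟩ := exists_isLinearization c.2
  exact ⟨⟨c₁, hc₁, h.hpull_eq⟩, h⟩

theorem diff_mem_linCochains {n : ℕ} {c : V.total.Cochain n} (hc : c ∈ V.linCochains n) :
    V.total.diff n c ∈ V.linCochains (n + 1) :=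
  ⟨diff_mem_defCochains hc.1, fun r => by
    rw [← diff_hpull (mem_defCochains.1 hc.1).1, hc.2 r]⟩

/-- The linearization map on deformation cochains. -/
noncomputable def linearization (V : VBGroupoid IG IM FW W FE E) (n : ℕ) :
    V.defCochains n →ₗ[ℝ] V.linCochains n where
  -- Limits are unique, so nothing is really chosen; linearity also follows from uniqueness.
  toFun c := (exists_linearization_mem_linCochains c).choose
  map_add' c d := by
    have h := (exists_linearization_mem_linCochains c).choose_spec.add_smul 1 1
      (exists_linearization_mem_linCochains d).choose_spec
    simp only [one_smul] at h
    exact Subtype.ext ((exists_linearization_mem_linCochains (c + d)).choose_spec.unique h)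
  map_smul' a c := by
    have h := (exists_linearization_mem_linCochains c).choose_spec.add_smul a 0
      (exists_linearization_mem_linCochains c).choose_spec
    simp only [zero_smul, add_zero] at h
    exact Subtype.ext ((exists_linearization_mem_linCochains (a • c)).choose_spec.unique h)

theorem isLinearization_linearization {n : ℕ} (c : V.defCochains n) :
    V.IsLinearization c.1 (V.linearization n c).1 :=
  (exists_linearization_mem_linCochains c).choose_spec

theorem linearization_of_mem {n : ℕ} {c : V.total.Cochain n} (hc : c ∈ V.linCochains n) :
    V.linearization n ⟨c, V.linCochains_le n hc⟩ = ⟨c, hc⟩ :=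
  Subtype.ext ((isLinearization_linearization _).unique (isLinearization_self hc))

theorem linearization_diff {n : ℕ} (c : V.defCochains n) :
    (V.linearization (n + 1) ⟨V.total.diff n c.1, diff_mem_defCochains c.2⟩).1 =
      V.total.diff n (V.linearization n c).1 :=
  (isLinearization_linearization _).unique ((isLinearization_linearization c).diff c.2)

/-- If a linear cocycle `c` equals `δd`, then `c = lin c = δ (lin d)` is a coboundary of a linear
cochain. -/
theorem cohomologyMap_injective (V : VBGroupoid IG IM FW W FE E) (n : ℕ) :
    Function.Injective (V.total.cohomologyMap V.linCochains_le n) := by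
  refine (injective_iff_map_eq_zero _).2 fun x => ?_
  obtain ⟨c, rfl⟩ := Submodule.Quotient.mk_surjective _ x
  intro h
  have hc : c.1 ∈ V.total.coboundaries V.defCochains n := (Submodule.Quotient.mk_eq_zero
    ((V.total.coboundaries V.defCochains n).submoduleOf (V.total.cocycles V.defCochains n))).1 h
  refine (Submodule.Quotient.mk_eq_zero _).2 (?_ : c.1 ∈ V.total.coboundaries V.linCochains n)
  cases n with
  -- In degree `-1` both complexes have only the zero coboundary.
  | zero => exact hc
  | succ n =>
    obtain ⟨d, hd, hdc⟩ := hc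
    refine ⟨(V.linearization n ⟨d, hd⟩).1, (V.linearization n ⟨d, hd⟩).2, ?_⟩
    rw [← linearization_diff]
    have hcl : c.1 ∈ V.linCochains (n + 1) := c.2.1
    have := congrArg Subtype.val (linearization_of_mem hcl)
    simpa only [hdc] using this

end VBGroupoid

theorem mainTheorem3
    {EG HG EM HM : Type*} [NormedAddCommGroup EG] [NormedSpace ℝ EG] [FiniteDimensional ℝ EG]
    [TopologicalSpace HG]
    [NormedAddCommGroup EM] [NormedSpace ℝ EM] [FiniteDimensional ℝ EM] [TopologicalSpace HM]
    {IG : ModelWithCorners ℝ EG HG} [IG.Boundaryless]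
    {IM : ModelWithCorners ℝ EM HM} [IM.Boundaryless]
    {G M : Type u} [TopologicalSpace G] [ChartedSpace HG G] [IsManifold IG ∞ G]
    [TopologicalSpace M] [ChartedSpace HM M] [IsManifold IM ∞ M]
    {FW : Type*} [NormedAddCommGroup FW] [NormedSpace ℝ FW] [FiniteDimensional ℝ FW]
    {W : G → Type u} [∀ g, AddCommGroup (W g)] [∀ g, Module ℝ (W g)]
    [∀ g, TopologicalSpace (W g)] [TopologicalSpace (TotalSpace FW W)]
    [FiberBundle FW W] [VectorBundle ℝ FW W] [ContMDiffVectorBundle ∞ FW W IG]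
    {FE : Type*} [NormedAddCommGroup FE] [NormedSpace ℝ FE] [FiniteDimensional ℝ FE]
    {E : M → Type u} [∀ x, AddCommGroup (E x)] [∀ x, Module ℝ (E x)]
    [∀ x, TopologicalSpace (E x)] [TopologicalSpace (TotalSpace FE E)]
    [FiberBundle FE E] [VectorBundle ℝ FE E] [ContMDiffVectorBundle ∞ FE E IM]
    (V : VBGroupoid IG IM FW W FE E) :
    -- the differential restricts to deformation cochains and to linear deformation cochains
    ∃ (hdef : ∀ n, ∀ c ∈ V.defCochains n, V.total.diff n c ∈ V.defCochains (n + 1))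
      (hlin : ∀ n, ∀ c ∈ V.linCochains n, V.total.diff n c ∈ V.linCochains (n + 1)),
      -- both are cochain complexes
      (∀ n, ∀ c ∈ V.defCochains n, V.total.diff (n + 1) (V.total.diff n c) = 0) ∧
      -- the linearization map is well defined and linear, with values in linear cochains
      ∃ lin : ∀ n, V.defCochains n →ₗ[ℝ] V.linCochains n,
        (∀ n (c : V.defCochains n), V.IsLinearization c.1 (lin n c).1) ∧
        -- it is a cochain map
        (∀ n, lin (n + 1) ∘ₗ (V.total.diff n).restrict (hdef n) =
          (V.total.diff n).restrict (hlin n) ∘ₗ lin n) ∧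
        -- it splits the inclusion of linear deformation cochains
        (∀ n, lin n ∘ₗ Submodule.inclusion (V.linCochains_le n) = LinearMap.id) ∧
        -- direct sum decomposition into linear cochains and the kernel, as cochain complexes
        (∀ n, IsCompl (LinearMap.range (Submodule.inclusion (V.linCochains_le n)))
          (LinearMap.ker (lin n))) ∧
        (∀ n, ∀ c ∈ LinearMap.ker (lin n),
          (V.total.diff n).restrict (hdef n) c ∈ LinearMap.ker (lin (n + 1))) ∧
        -- the inclusion induces an injection in cohomology
        (∀ n, Function.Injective (V.total.cohomologyMap V.linCochains_le n)) := by
  refine ⟨fun n c hc => LieGroupoid.diff_mem_defCochains hc,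
    fun n c hc => VBGroupoid.diff_mem_linCochains hc,
    fun n c hc => LieGroupoid.diff_diff (LieGroupoid.mem_defCochains.1 hc).1,
    V.linearization, fun n c => VBGroupoid.isLinearization_linearization c, ?_, ?_, ?_, ?_,
    V.cohomologyMap_injective⟩
  · exact fun n => LinearMap.ext fun c => Subtype.ext (VBGroupoid.linearization_diff c)
  · exact fun n => LinearMap.ext fun c => VBGroupoid.linearization_of_mem c.2
  · exact fun n => LinearMap.isCompl_range_ker_of_comp_eq_id
      (LinearMap.ext fun c => VBGroupoid.linearization_of_mem c.2)
  · intro n c hc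
    refine LinearMap.mem_ker.2 (Subtype.ext ((VBGroupoid.linearization_diff c).trans ?_))
    rw [LinearMap.mem_ker.1 hc]
    exact map_zero (V.total.diff n)
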